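/- Let $2\le d\le\alpha<\infty$ (with $d$ an integer and $\alpha$ real) and $s>d$. There is a constant $C>0$ depending only on $d,\alpha,s$ such that the following holds. Let $\kappa>0$, $r_0\ge 0$, and let $w:\mathbb{R}^d\to\mathbb{R}\cup\{+\infty\}$ be an even lower semi-continuous function which is stable, $\sum_{1\le j<k\le N}w(x_j-x_k)\ge-\kappa N$ for all $N\in\mathbb{N}$ and $x_1,\dots,x_N\in\mathbb{R}^d$, and upper regular, $w(x)\le\kappa\big(\mathbf 1(|x|<r_0)(r_0/|x|)^\alpha+\frac1{1+|x|^s}\big)$ for all $x$. Let $T>0$, and let $0\le\rho\in L^1(\mathbb{R}^d)$ with $\int\rho=N\in\mathbb{N}$, $N\ge2$, and $\int\rho|\log\rho|<\infty$. Let $R(x)$ denote the largest number such that $\int_{B(x,R(x))}\rho=1$. The canonical free energy of $\rho$ is $$F_T[\rho]=\inf_{\rho_{\mathbb P}=\rho}\Big\{\int_{\mathbb{R}^{dN}}\sum_{1\le j<k\le N}w(x_j-x_k)\,d\mathbb P(x)+T\int_{\mathbb{R}^{dN}}\mathbb P\log(N!\,\mathbb P)\Big\},$$ where the infimum is over the symmetric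 Borel probability measures $\mathbb P$ on $(\mathbb{R}^d)^N$ whose one-body density $\rho_{\mathbb P}$ ($N$ times the first marginal) equals $\rho$, and where the last term is $+\infty$ if $\mathbb P$ is not absolutely continuous with respect to the Lebesgue measure. Then $$F_T[\rho]\le C(\kappa+T)\int\rho^2+CT\int\rho+T\int\rho\log\rho+T\int\rho\log R^d+ \begin{cases}C\kappa r_0^\alpha\displaystyle\int\rho^{1+\frac\alpha d}&\text{if }\alpha>d,\\[2mm] C\kappa r_0^d\Big(\displaystyle\int\rho^2+\int\rho^2\big(\log (r_0^d\rho)\big)_+\Big)&\text{if }\alpha=d,\end{cases}$$ where all integrals are over $\mathbb{R}^d$, the right side is understood in $(-\infty,+\infty]$, and the last term is $0$ if $r_0=0$. -/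

import Mathlib

open MeasureTheory Filter Topology
open scoped ENNReal

noncomputable section

namespace CanonicalGas

/-- The Euclidean space `ℝ^d`. -/
abbrev E (d : ℕ) : Type := EuclideanSpace ℝ (Fin d)

/-- Integral, with values in `[-∞, ∞]`, of an extended-real function: the integral of the positive
part minus that of the negative part. Below it is only applied to functions whose negative part has
a finite integral, so that no difference `∞ - ∞` arises. -/
def eintegral {X : Type*} [MeasurableSpace X] (μ : Measure X) (f : X → EReal) : EReal :=
  ((∫⁻ x, (f x).toENNReal ∂μ : ℝ≥0∞) : EReal) - ((∫⁻ x, (-f x).toENNReal ∂μ : ℝ≥0∞) : EReal)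

/-- `∑_{j < k} w (x_j - x_k)` for a configuration of `N` points. -/
def pairEnergy {d N : ℕ} (w : E d → EReal) (x : Fin N → E d) : EReal :=
  ∑ p : Fin N × Fin N with p.1 < p.2, w (x p.1 - x p.2)

/-- The upper bound `κ (𝟙(|x| < r₀) (r₀/|x|)^α + 1/(1+|x|^s))`, with values in `[0, ∞]`: for
`r₀ > 0` and `α > 0` it is `∞` at the origin. -/
def upperProfile {d : ℕ} (κ r₀ α s : ℝ) (x : E d) : ℝ≥0∞ :=
  ENNReal.ofReal κ *
    ((if ‖x‖ < r₀ then (ENNReal.ofReal r₀ / ENNReal.ofReal ‖x‖) ^ α else 0) +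
      ENNReal.ofReal (1 / (1 + ‖x‖ ^ s)))

/-- The assumption on the short-range pair potential `w : ℝ^d → ℝ ∪ {+∞}` with finite power `α`
at the origin: `w` is even, lower semi-continuous, stable and upper regular. -/
structure IsShortRange {d : ℕ} (w : E d → EReal) (κ r₀ α s : ℝ) : Prop where
  kappa_pos : 0 < κ
  r₀_nonneg : 0 ≤ r₀
  alpha_nonneg : 0 ≤ α
  dim_lt_s : (d : ℝ) < s
  ne_bot : ∀ x, w x ≠ ⊥
  even : ∀ x, w (-x) = w x
  lsc : LowerSemicontinuous w
  stable : ∀ (N : ℕ) (x : Fin N → E d), ((-(κ * N) : ℝ) : EReal) ≤ pairEnergy w x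
  upper_regular : ∀ x, w x ≤ ((upperProfile κ r₀ α s x : ℝ≥0∞) : EReal)

/-- Symmetric `N`-particle probability measures on `(ℝ^d)^N`. -/
structure IsState {d N : ℕ} (P : Measure (Fin N → E d)) : Prop where
  prob : IsProbabilityMeasure P
  symm : ∀ σ : Equiv.Perm (Fin N), P.map (fun x i => x (σ i)) = P

/-- The one-body density `ρ_P`, as a measure of total mass `N`: the sum of the `N` marginals of `P`
(which, for a symmetric `P`, is `N` times the first marginal). -/
def oneBody {d N : ℕ} (P : Measure (Fin N → E d)) : Measure (E d) :=
  ∑ j : Fin N, P.map (fun x => x j)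

/-- The average interaction energy `U_N(P)`. -/
def interactionEnergy {d N : ℕ} (w : E d → EReal) (P : Measure (Fin N → E d)) : EReal :=
  eintegral P (pairEnergy w)

open Classical in
/-- The entropy `S_N(P) = -∫ P log (N! P)`, equal to `-∞` if `P` is not absolutely continuous with
respect to the Lebesgue measure. -/
def entropy {d N : ℕ} (P : Measure (Fin N → E d)) : EReal :=
  if P ≪ volume then
    -eintegral volume (fun x =>
      (((P.rnDeriv volume x).toReal *
        Real.log ((N.factorial : ℝ) * (P.rnDeriv volume x).toReal) : ℝ) : EReal))
  else ⊥

/-- The free energy `𝓕_T(P) = U_N(P) - T S_N(P)` of a state. -/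
def stateFreeEnergy {d N : ℕ} (w : E d → EReal) (T : ℝ) (P : Measure (Fin N → E d)) : EReal :=
  interactionEnergy w P - (T : EReal) * entropy P

/-- The canonical free energy `F_T[ρ]`: the infimum of `𝓕_T(P)` over the `N`-particle states `P`
whose one-body density is `ρ`. -/
def canonicalFreeEnergy {d : ℕ} (w : E d → EReal) (T : ℝ) (N : ℕ) (ρ : E d → ℝ) : EReal :=
  sInf {e : EReal | ∃ P : Measure (Fin N → E d), IsState P ∧
    oneBody P = volume.withDensity (fun x => ENNReal.ofReal (ρ x)) ∧ e = stateFreeEnergy w T P}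

/-- The local radius `R(x)`: the largest number such that `∫_{B(x,R(x))} ρ = 1`. -/
def localRadius {d : ℕ} (ρ : E d → ℝ) (x : E d) : ℝ :=
  sSup {r : ℝ | ∫ y in Metric.ball x r, ρ y = 1}

/-- If `∫ ρ > 1`, the local radius is well defined: there is a largest radius. -/
theorem localRadius_isGreatest {d : ℕ} (hd : 1 ≤ d) {ρ : E d → ℝ} (hρ : Integrable ρ)
    (h1 : 1 < ∫ y, ρ y) (x : E d) :
    IsGreatest {r : ℝ | ∫ y in Metric.ball x r, ρ y = 1} (localRadius ρ x) := by
  have : NeZero d := ⟨by omega⟩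
  have hc : Continuous fun r : ℝ => ∫ y in Metric.ball x r, ρ y := by
    rw [continuous_iff_continuousAt]
    intro r
    have key : ContinuousAt (fun r : ℝ => ∫ y, (Metric.ball x r).indicator ρ y) r := by
      refine continuousAt_of_dominated (bound := fun y => ‖ρ y‖) ?_ ?_ hρ.norm ?_
      · exact Eventually.of_forall fun r =>
          hρ.aestronglyMeasurable.indicator Metric.isOpen_ball.measurableSet
      · exact Eventually.of_forall fun r => Eventually.of_forall fun y =>
          norm_indicator_le_norm_self _ _
      · have hs : volume (Metric.sphere x r) = 0 := Measure.addHaar_sphere volume x r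
        filter_upwards [measure_eq_zero_iff_ae_notMem.1 hs] with y hy
        have hy' : dist y x ≠ r := hy
        rcases lt_or_gt_of_ne hy' with h | h
        · refine (continuousAt_const (y := ρ y)).congr ?_
          filter_upwards [lt_mem_nhds h] with t ht
          rw [Set.indicator_of_mem (Metric.mem_ball.2 ht)]
        · refine (continuousAt_const (y := (0 : ℝ))).congr ?_
          filter_upwards [gt_mem_nhds h] with t ht
          rw [Set.indicator_of_notMem]
          simpa using ht.le
    simpa only [integral_indicator Metric.isOpen_ball.measurableSet] using key
  have hlim : Tendsto (fun r : ℝ => ∫ y in Metric.ball x r, ρ y) atTop (𝓝 (∫ y, ρ y)) := by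
    have := tendsto_integral_filter_of_dominated_convergence (μ := volume) (l := atTop)
      (F := fun (r : ℝ) y => (Metric.ball x r).indicator ρ y) (f := ρ) (fun y => ‖ρ y‖)
      (Eventually.of_forall fun r =>
          hρ.aestronglyMeasurable.indicator Metric.isOpen_ball.measurableSet)
      (Eventually.of_forall fun r => Eventually.of_forall fun y =>
          norm_indicator_le_norm_self _ _) hρ.norm
      (Eventually.of_forall fun y => by
        refine tendsto_const_nhds.congr' ?_
        filter_upwards [eventually_gt_atTop (dist y x)] with t ht
        rw [Set.indicator_of_mem (Metric.mem_ball.2 ht)])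
    simpa only [integral_indicator Metric.isOpen_ball.measurableSet] using this
  obtain ⟨b, hb⟩ := eventually_atTop.1 (hlim.eventually (lt_mem_nhds h1))
  have hne : {r : ℝ | ∫ y in Metric.ball x r, ρ y = 1}.Nonempty := by
    have hmem : (1 : ℝ) ∈ Set.Icc (∫ y in Metric.ball x 0, ρ y)
        (∫ y in Metric.ball x (max b 0), ρ y) := by
      refine ⟨by simp, (hb _ (le_max_left _ _)).le⟩
    obtain ⟨r, -, hr⟩ := intermediate_value_Icc (le_max_right b 0) hc.continuousOn hmem
    exact ⟨r, hr⟩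
  have hbdd : BddAbove {r : ℝ | ∫ y in Metric.ball x r, ρ y = 1} := by
    refine ⟨b, fun r hr => ?_⟩
    by_contra h
    have := hb r (not_le.1 h).le
    have hr1 : ∫ y in Metric.ball x r, ρ y = 1 := hr
    linarith
  have hcl : IsClosed {r : ℝ | ∫ y in Metric.ball x r, ρ y = 1} :=
    isClosed_eq hc continuous_const
  exact ⟨hcl.csSup_mem hne hbdd, fun r hr => le_csSup hbdd hr⟩

/-- The contribution of the singularity of `w` at the origin to the upper bound, in `[0, ∞]`:
`C κ r₀^α ∫ ρ^(1+α/d)` if `α > d`, and `C κ r₀^d (∫ ρ² + ∫ ρ² (log (r₀^d ρ))₊)` if `α = d`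
(the only remaining case when `d ≤ α`); it vanishes for `r₀ = 0`. -/
def coreTerm {d : ℕ} (C κ r₀ α : ℝ) (ρ : E d → ℝ) : ℝ≥0∞ :=
  if (d : ℝ) < α then
    ENNReal.ofReal (C * κ * r₀ ^ α) * ∫⁻ x, ENNReal.ofReal (ρ x) ^ (1 + α / d)
  else
    ENNReal.ofReal (C * κ * r₀ ^ d) *
      ((∫⁻ x, ENNReal.ofReal (ρ x) ^ 2) +
        ∫⁻ x, ENNReal.ofReal (ρ x) ^ 2 * ENNReal.ofReal (max (Real.log (r₀ ^ d * ρ x)) 0))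

end CanonicalGas

end

/-!
The trial state keeps the particles apart at a distance that adapts to the local density.

For `x` in the space let `2 ^ (-k)` be the largest dyadic length such that the cube of side
`3 · 2 ^ (-k)` around `x`, formed by dyadic cubes of side `2 ^ (-k)`, has `ρ`-mass at most `1 / 4`;
`k` is the local scale at `x`. A ball of radius `2 ^ (-k)` around `x` lies in this cube, so that
`2 ^ (-k)` is less than the local radius `R(x)`. Cut the level sets of the scale into pieces by the
dyadic cubes of side `2 ^ (-(k + 1))`, and call two pieces near if these cubes touch, at the coarser
of the two resolutions. Near pieces have scales that differ by at most `1`, and all the pieces near a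
given one lie in a cube of mass at most `1 / 4`. To have finitely many pieces, the points of very
coarse scale, of total mass at most `1 / 4`, are put into one part.

*Separation.* If each index of a finite set conflicts with mass at most `1 / 2` of a weight of total
mass `N`, the weight is the marginal of a symmetric probability distribution on `N`-tuples without
conflicts (`exists_symmetric_conflictFree`): in a distribution that minimises the expected number of
conflicts, a conflicting entry could be exchanged with an entry of another tuple so as to lower that
number. Applied to the pieces (`exists_separated_transport`), this gives a mixture of products of
normalised restrictions of `ρ` to pieces, whose one-body density is `ρ` and in which no two particles
are near.

*Entropy.* Conflict-free tuples have distinct entries, so each has probability at most `1 / N!`, and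
the entropy term is at most `∫ ρ log (ρ / m)`, where `m` is the mass of the part of the point.
Writing `1 / m` as `2 ^ (-kd) · (2 ^ (kd) / m)` and using `log t ≤ t` gives
`∫ ρ log ρ + ∫ ρ log 2 ^ (-kd) + ∫ ρ 2 ^ (kd) / m`. In the second integral `2 ^ (-k) < R`.

*Energy.* Charge each pair to its point of finer scale `k`. The other points lie in distinct cubes of
side `2 ^ (-(k + 1))`, none of them adjacent to the cube of that point, so the energy per point is at
most a sum over dyadic shells that depends on `k` only (`sum_pairs_le_sum_shellSum`).

*Counting.* It remains to bound `∫ ρ a(k) / m` for functions `a` of the scale. The next larger cube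
around a point of scale `k` has mass more than `1 / 4`, hence a definite mass of `ρ` restricted to
`{ρ > c 2 ^ (kd)}`; these cubes have bounded overlap, so the number of pieces of scale `k` is at most a
constant times `∫ ρ 1(ρ > c 2 ^ (kd))` (`exists_lintegral_inv_pieceMass_le`). Summing geometric series
in `k` gives `∫ ρ²` for `a(k) = 2 ^ (kd)`, and the energy terms on the right-hand side, with the
logarithm for `α = d`, when `a` is the shell sum (`exists_lintegral_shellSum_scale_le`).
-/

noncomputable section

namespace CanonicalGas

/-! ### Fractional independent sets -/

open Classical in
/-- The number of ordered pairs of distinct coordinates of a tuple that are in conflict. -/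
def conflictCount {ι : Type*} {N : ℕ} (r : ι → ι → Prop) (x : Fin N → ι) : ℝ :=
  ∑ p : Fin N × Fin N, if p.1 ≠ p.2 ∧ r (x p.1) (x p.2) then 1 else 0

theorem sum_comp_update {ι : Type*} {N : ℕ} (H : ι → ℝ) (x : Fin N → ι) (j : Fin N) (b : ι) :
    ∑ k, H (Function.update x j b k) = ∑ k, H (x k) - H (x j) + H b := by
  rw [← Finset.add_sum_erase _ _ (Finset.mem_univ j),
    ← Finset.add_sum_erase _ (fun k => H (x k)) (Finset.mem_univ j)]
  have : ∑ k ∈ Finset.univ.erase j, H (Function.update x j b k)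
      = ∑ k ∈ Finset.univ.erase j, H (x k) := by
    refine Finset.sum_congr rfl fun k hk => ?_
    rw [Function.update_of_ne (Finset.ne_of_mem_erase hk)]
  rw [this]
  simp
  ring

theorem conflict_of_conflict_update {ι : Type*} {N : ℕ} {r : ι → ι → Prop}
    (hsymm : ∀ i j, r i j → r j i) (x : Fin N → ι) (j : Fin N) (b : ι)
    (hb : ∀ k, k ≠ j → ¬ r b (x k)) (p : Fin N × Fin N) :
    ((p.1 ≠ p.2 ∧ r (Function.update x j b p.1) (Function.update x j b p.2)) →
      p.1 ≠ j ∧ p.2 ≠ j ∧ p.1 ≠ p.2 ∧ r (x p.1) (x p.2)) := by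
  rintro ⟨hne, hr⟩
  have h1 : p.1 ≠ j := by
    intro h
    rw [h, Function.update_self, Function.update_of_ne (by rw [← h]; exact hne.symm)] at hr
    exact hb _ (by rw [← h]; exact hne.symm) hr
  have h2 : p.2 ≠ j := by
    intro h
    rw [h, Function.update_self, Function.update_of_ne h1] at hr
    exact hb _ h1 (hsymm _ _ hr)
  rw [Function.update_of_ne h1, Function.update_of_ne h2] at hr
  exact ⟨h1, h2, hne, hr⟩

theorem sum_mul_sum_apply_of_marginals {ι : Type*} [Fintype ι] [DecidableEq ι] {N : ℕ}
    {p : (Fin N → ι) → ℝ} {m : ι → ℝ}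
    (hp : ∀ i, ∑ x, p x * ∑ k, (if x k = i then (1 : ℝ) else 0) = m i) (H : ι → ℝ) :
    ∑ x, p x * ∑ k, H (x k) = ∑ i, m i * H i := by
  simp_rw [← hp, Finset.sum_mul]
  rw [Finset.sum_comm]
  refine Finset.sum_congr rfl fun x _ => ?_
  simp_rw [mul_assoc, ← Finset.mul_sum]
  congr 1
  simp_rw [Finset.sum_mul]
  rw [Finset.sum_comm]
  simp

/-- A swapping step: in a distribution on tuples whose marginals put mass at most `1 / 2` on the
conflicts of any given index, a tuple `x` can exchange its `j₀`-th entry with an entry of some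
tuple `y` of positive probability, so that neither exchanged entry causes a conflict. -/
theorem exists_swap {ι : Type*} [Fintype ι] [DecidableEq ι] {N : ℕ} (hN : 0 < N)
    {p : (Fin N → ι) → ℝ} {m : ι → ℝ} (hp0 : ∀ x, 0 ≤ p x)
    (hp : ∀ i, ∑ x, p x * ∑ k, (if x k = i then (1 : ℝ) else 0) = m i)
    (hm : ∑ i, m i = N) (r : ι → ι → Prop) [DecidableRel r]
    (hdeg : ∀ i, ∑ j, (if r j i then m j else 0) ≤ 1 / 2) (x : Fin N → ι) (j₀ : Fin N) :
    ∃ y, p y ≠ 0 ∧ (∀ k, ¬ r (y k) (x j₀)) ∧ ∃ j, ∀ k, k ≠ j₀ → ¬ r (y j) (x k) := by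
  by_contra! hcon
  have hNpos : (0 : ℝ) < N := by exact_mod_cast hN
  have hsum : ∑ y, p y = 1 := by
    have := sum_mul_sum_apply_of_marginals hp (fun _ => (1 : ℝ))
    simp only [Finset.sum_const, Finset.card_univ, Fintype.card_fin, nsmul_eq_mul, mul_one, hm,
      ← Finset.sum_mul] at this
    exact mul_right_cancel₀ hNpos.ne' (by rw [this, one_mul])
  -- expected number of conflicts of `y` with `x j₀`, plus the average over the entries of `y` of
  -- the expected number of conflicts with the other entries of `x`
  let H : ι → ℝ := fun i => (if r i (x j₀) then 1 else 0) +
    (N : ℝ)⁻¹ * ∑ k ∈ Finset.univ.erase j₀, if r i (x k) then 1 else 0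
  have hH := sum_mul_sum_apply_of_marginals hp H
  have hlow : ∀ y, p y ≤ p y * ∑ k, H (y k) := by
    intro y
    rcases eq_or_ne (p y) 0 with h0 | h0
    · simp [h0]
    refine le_mul_of_one_le_right (hp0 y) ?_
    simp only [H, Finset.sum_add_distrib, ← Finset.mul_sum]
    have hB0 : (0 : ℝ) ≤ (N : ℝ)⁻¹ * ∑ j, ∑ k ∈ Finset.univ.erase j₀,
        (if r (y j) (x k) then (1 : ℝ) else 0) := by positivity
    have hA0 : (0 : ℝ) ≤ ∑ k, (if r (y k) (x j₀) then (1 : ℝ) else 0) := by positivity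
    by_cases hA : ∀ k, ¬ r (y k) (x j₀)
    · have hB := hcon y h0 hA
      have : (N : ℝ) ≤ ∑ j, ∑ k ∈ Finset.univ.erase j₀, (if r (y j) (x k) then (1 : ℝ) else 0) := by
        calc (N : ℝ) = ∑ j : Fin N, (1 : ℝ) := by simp
          _ ≤ _ := Finset.sum_le_sum fun j _ => by
            obtain ⟨k, hk, hr⟩ := hB j
            have := Finset.single_le_sum (f := fun k => if r (y j) (x k) then (1 : ℝ) else 0)
              (fun k _ => by positivity) (Finset.mem_erase.2 ⟨hk, Finset.mem_univ k⟩)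
            simpa [hr] using this
      have h1 : (1 : ℝ) ≤ (N : ℝ)⁻¹ * ∑ j, ∑ k ∈ Finset.univ.erase j₀,
          (if r (y j) (x k) then (1 : ℝ) else 0) := by
        calc (1 : ℝ) = (N : ℝ)⁻¹ * N := by field_simp
          _ ≤ _ := by gcongr
      linarith
    · push Not at hA
      obtain ⟨k, hr⟩ := hA
      have := Finset.single_le_sum (f := fun k => if r (y k) (x j₀) then (1 : ℝ) else 0)
        (fun k _ => by positivity) (Finset.mem_univ k)
      have : (1 : ℝ) ≤ ∑ k, (if r (y k) (x j₀) then (1 : ℝ) else 0) := by simpa [hr] using this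
      linarith
  have hup : ∑ i, m i * H i ≤ 1 / 2 + (N : ℝ)⁻¹ * ((N - 1) * (1 / 2)) := by
    simp only [H, mul_add, Finset.sum_add_distrib]
    refine add_le_add ?_ ?_
    · simpa using hdeg (x j₀)
    · have : ∑ i, m i * ((N : ℝ)⁻¹ * ∑ k ∈ Finset.univ.erase j₀, if r i (x k) then (1 : ℝ) else 0)
          = (N : ℝ)⁻¹ * ∑ k ∈ Finset.univ.erase j₀, ∑ i, if r i (x k) then m i else 0 := by
        rw [Finset.sum_comm, Finset.mul_sum]
        refine Finset.sum_congr rfl fun i _ => ?_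
        rw [mul_left_comm, Finset.mul_sum]
        simp
      rw [this]
      gcongr
      calc _ ≤ ∑ k ∈ Finset.univ.erase j₀, (1 / 2 : ℝ) := Finset.sum_le_sum fun k _ => hdeg _
        _ = _ := by
          rw [Finset.sum_const, Finset.card_erase_of_mem (Finset.mem_univ _)]
          simp [Nat.cast_sub (Nat.succ_le_of_lt hN)]
  have h1 : (1 : ℝ) ≤ ∑ i, m i * H i := by
    rw [← hH, ← hsum]
    exact Finset.sum_le_sum fun y _ => hlow y
  have h2 : 1 / 2 + (N : ℝ)⁻¹ * ((N - 1) * (1 / 2)) = 1 - (N : ℝ)⁻¹ / 2 := by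
    field_simp
    ring
  have : 0 < (N : ℝ)⁻¹ := by positivity
  linarith

/-- If a weight `m` of total mass `N` gives mass at most `1 / 2` to the conflicts of each index,
it is the sum of the marginals of a probability distribution on conflict-free `N`-tuples. The
distribution minimises the expected number of conflicts; a swap would decrease it further. -/
theorem exists_conflictFree {ι : Type*} [Fintype ι] [DecidableEq ι] {N : ℕ} (hN : 0 < N)
    {m : ι → ℝ} (hm0 : ∀ i, 0 ≤ m i) (hm : ∑ i, m i = N) (r : ι → ι → Prop) [DecidableRel r]
    (hrefl : ∀ i, r i i) (hsymm : ∀ i j, r i j → r j i)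
    (hdeg : ∀ i, ∑ j, (if r j i then m j else 0) ≤ 1 / 2) :
    ∃ p : (Fin N → ι) → ℝ, (∀ x, 0 ≤ p x) ∧
      (∀ i, ∑ x, p x * ∑ k, (if x k = i then (1 : ℝ) else 0) = m i) ∧
      ∀ x, p x ≠ 0 → ∀ j k, j ≠ k → ¬ r (x j) (x k) := by
  have hNpos : (0 : ℝ) < N := by exact_mod_cast hN
  let K : Set ((Fin N → ι) → ℝ) := {p | (∀ x, 0 ≤ p x) ∧
      ∀ i, ∑ x, p x * ∑ k, (if x k = i then (1 : ℝ) else 0) = m i}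
  have hKc : IsClosed K := by
    have h1 : K = (⋂ x, {p | 0 ≤ p x}) ∩
        ⋂ i, {p | ∑ x, p x * ∑ k, (if x k = i then (1 : ℝ) else 0) = m i} := by
      ext p
      simp [K]
    rw [h1]
    exact (isClosed_iInter fun x => isClosed_le continuous_const (continuous_apply x)).inter
      (isClosed_iInter fun i => isClosed_eq (by fun_prop) continuous_const)
  have hKb : K ⊆ Set.Icc 0 (fun x => m (x ⟨0, hN⟩)) := by
    rintro p ⟨h0, h1⟩
    refine ⟨h0, fun x => ?_⟩
    change p x ≤ m (x ⟨0, hN⟩)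
    rw [← h1]
    have hx := Finset.single_le_sum (f := fun y : Fin N → ι => p y *
      ∑ k, (if y k = x ⟨0, hN⟩ then (1 : ℝ) else 0))
      (fun y _ => mul_nonneg (h0 y) (by positivity)) (Finset.mem_univ x)
    refine le_trans (le_mul_of_one_le_right (h0 x) ?_) hx
    have := Finset.single_le_sum (f := fun k => if x k = x ⟨0, hN⟩ then (1 : ℝ) else 0)
      (fun k _ => by positivity) (Finset.mem_univ ⟨0, hN⟩)
    simpa using this
  have hKcomp : IsCompact K := isCompact_Icc.of_isClosed_subset hKc hKb
  -- the constant tuples, with weights proportional to `m`, have the right marginals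
  have hKne : K.Nonempty := by
    refine ⟨fun x => ∑ i, if x = (fun _ => i) then m i / N else 0, fun x => ?_, fun i => ?_⟩
    · refine Finset.sum_nonneg fun i _ => ?_
      split_ifs
      · exact div_nonneg (hm0 i) hNpos.le
      · exact le_rfl
    · simp_rw [Finset.sum_mul]
      rw [Finset.sum_comm]
      simp only [ite_mul, zero_mul, Finset.sum_ite_eq', Finset.mem_univ, if_true]
      simp only [Finset.sum_const, Finset.card_univ, Fintype.card_fin, nsmul_eq_mul, mul_ite,
        mul_one, mul_zero, Finset.sum_ite_eq', Finset.mem_univ, if_true]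
      field_simp
  have hcont : Continuous fun p : (Fin N → ι) → ℝ => ∑ x, p x * conflictCount r x := by fun_prop
  obtain ⟨p, ⟨hp0, hp⟩, hmin⟩ := hKcomp.exists_isMinOn hKne hcont.continuousOn
  refine ⟨p, hp0, hp, fun X hX j₀ k₀ hjk hr => ?_⟩
  obtain ⟨Y, hY, hYa, j, hj⟩ := exists_swap hN hp0 hp hm r hdeg X j₀
  have hXY : X ≠ Y := fun h => hYa j₀ (by rw [h]; exact hrefl _)
  let X' := Function.update X j₀ (Y j)
  let Y' := Function.update Y j (X j₀)
  -- moving the mass `δ` from `X`, `Y` to the tuples after the swap preserves the marginals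
  let δ := min (p X) (p Y)
  have hδ : 0 < δ := lt_min ((hp0 X).lt_of_ne' hX) ((hp0 Y).lt_of_ne' hY)
  let e : (Fin N → ι) → (Fin N → ι) → ℝ := fun Z x => if x = Z then 1 else 0
  let p' : (Fin N → ι) → ℝ := fun x => p x + δ * (e X' x + e Y' x - e X x - e Y x)
  have hlin : ∀ g : (Fin N → ι) → ℝ, ∑ x, p' x * g x =
      ∑ x, p x * g x + δ * (g X' + g Y' - g X - g Y) := by
    intro g
    simp only [p', e, add_mul, mul_assoc, sub_mul, Finset.sum_add_distrib, ← Finset.mul_sum,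
      Finset.sum_sub_distrib, ite_mul, one_mul, zero_mul, Finset.sum_ite_eq', Finset.mem_univ,
      if_true]
  have hp'K : p' ∈ K := by
    refine ⟨fun x => ?_, fun i => ?_⟩
    · have e0 : ∀ Z, 0 ≤ e Z x := fun Z => by simp only [e]; positivity
      have h1 : δ * (e X x + e Y x) ≤ p x := by
        by_cases h : x = X
        · have : x ≠ Y := h ▸ hXY
          simp only [e, h, hXY, if_true, if_false]
          simp [δ]
        · by_cases h' : x = Y
          · simp only [e, h', hXY.symm, if_true, if_false]
            simp [δ]
          · simpa [e, h, h'] using hp0 x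
      have h2 : 0 ≤ δ * (e X' x + e Y' x) := mul_nonneg hδ.le (add_nonneg (e0 _) (e0 _))
      have : p' x = p x + δ * (e X' x + e Y' x) - δ * (e X x + e Y x) := by simp only [p']; ring
      linarith
    · rw [hlin, hp, sum_comp_update (fun z => if z = i then (1 : ℝ) else 0),
        sum_comp_update (fun z => if z = i then (1 : ℝ) else 0)]
      ring
  have hcY : conflictCount r Y' ≤ conflictCount r Y := by
    refine Finset.sum_le_sum fun q _ => ?_
    by_cases h : q.1 ≠ q.2 ∧ r (Y' q.1) (Y' q.2)
    · obtain ⟨-, -, h'⟩ := conflict_of_conflict_update hsymm Y j (X j₀)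
        (fun k _ hk => hYa k (hsymm _ _ hk)) q h
      rw [if_pos h, if_pos h']
    · rw [if_neg h]
      positivity
  have hcX : conflictCount r X' < conflictCount r X := by
    refine Finset.sum_lt_sum (fun q _ => ?_) ⟨(j₀, k₀), Finset.mem_univ _, ?_⟩
    · by_cases h : q.1 ≠ q.2 ∧ r (X' q.1) (X' q.2)
      · obtain ⟨-, -, h'⟩ := conflict_of_conflict_update hsymm X j₀ (Y j) hj q h
        rw [if_pos h, if_pos h']
      · rw [if_neg h]
        positivity
    · have h1 : ¬ ((j₀, k₀).1 ≠ (j₀, k₀).2 ∧ r (X' (j₀, k₀).1) (X' (j₀, k₀).2)) :=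
        fun h => (conflict_of_conflict_update hsymm X j₀ (Y j) hj (j₀, k₀) h).1 rfl
      have h2 : (j₀, k₀).1 ≠ (j₀, k₀).2 ∧ r (X (j₀, k₀).1) (X (j₀, k₀).2) := ⟨hjk, hr⟩
      rw [if_neg h1, if_pos h2]
      exact one_pos
  have := hmin hp'K
  simp only [Set.mem_ofPred_eq, hlin] at this
  have h3 : δ * (conflictCount r X' + conflictCount r Y' - conflictCount r X - conflictCount r Y) < 0 :=
    mul_neg_of_pos_of_neg hδ (by linarith)
  linarith

/-- A symmetric version of `exists_conflictFree`; by symmetry and since the entries of a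
conflict-free tuple are distinct, each tuple has probability at most `1 / N!`. -/
theorem exists_symmetric_conflictFree {ι : Type*} [Fintype ι] [DecidableEq ι] {N : ℕ} (hN : 0 < N)
    {m : ι → ℝ} (hm0 : ∀ i, 0 ≤ m i) (hm : ∑ i, m i = N) (r : ι → ι → Prop) [DecidableRel r]
    (hrefl : ∀ i, r i i) (hsymm : ∀ i j, r i j → r j i)
    (hdeg : ∀ i, ∑ j, (if r j i then m j else 0) ≤ 1 / 2) :
    ∃ p : (Fin N → ι) → ℝ, (∀ x, 0 ≤ p x) ∧
      (∀ (σ : Equiv.Perm (Fin N)) x, p (x ∘ σ) = p x) ∧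
      (∀ i, ∑ x, p x * ∑ k, (if x k = i then (1 : ℝ) else 0) = m i) ∧
      (∀ x, p x ≠ 0 → ∀ j k, j ≠ k → ¬ r (x j) (x k)) ∧
      ∀ x, N.factorial * p x ≤ 1 := by
  obtain ⟨p, hp0, hp, hpr⟩ := exists_conflictFree hN hm0 hm r hrefl hsymm hdeg
  have hf : (0 : ℝ) < N.factorial := by exact_mod_cast N.factorial_pos
  have hcard : (Fintype.card (Equiv.Perm (Fin N)) : ℝ) = N.factorial := by
    rw [Fintype.card_perm, Fintype.card_fin]
  let q : (Fin N → ι) → ℝ := fun x => (N.factorial : ℝ)⁻¹ * ∑ σ : Equiv.Perm (Fin N), p (x ∘ σ)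
  have hqm : ∀ i, ∑ x, q x * ∑ k, (if x k = i then (1 : ℝ) else 0) = m i := by
    intro i
    simp only [q, mul_assoc, ← Finset.mul_sum, Finset.sum_mul]
    rw [Finset.sum_comm]
    have : ∀ σ : Equiv.Perm (Fin N), ∑ x : Fin N → ι, p (x ∘ σ) *
        ∑ k, (if x k = i then (1 : ℝ) else 0) = m i := by
      intro σ
      rw [← hp i]
      refine Fintype.sum_equiv (Equiv.arrowCongr σ.symm (Equiv.refl ι)) _ _ fun x => ?_
      have h1 : (Equiv.arrowCongr σ.symm (Equiv.refl ι) x) = x ∘ σ := by ext k; simp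
      rw [h1]
      congr 1
      exact (Equiv.sum_comp σ fun k => if x k = i then (1 : ℝ) else 0).symm
    simp only [this, Finset.sum_const, Finset.card_univ, nsmul_eq_mul, hcard]
    field_simp
  have hsum : ∑ y, p y = 1 := by
    have hNpos : (0 : ℝ) < N := by exact_mod_cast hN
    have := sum_mul_sum_apply_of_marginals hp (fun _ => (1 : ℝ))
    simp only [Finset.sum_const, Finset.card_univ, Fintype.card_fin, nsmul_eq_mul, mul_one, hm,
      ← Finset.sum_mul] at this
    exact mul_right_cancel₀ hNpos.ne' (by rw [this, one_mul])
  have hqr : ∀ x, q x ≠ 0 → ∀ j k, j ≠ k → ¬ r (x j) (x k) := by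
    intro x hx j k hjk hr
    obtain ⟨σ, -, hσ⟩ := Finset.exists_ne_zero_of_sum_ne_zero (right_ne_zero_of_mul hx)
    exact hpr _ hσ (σ.symm j) (σ.symm k) (by simpa using hjk) (by simpa using hr)
  refine ⟨q, fun x => ?_, fun σ x => ?_, hqm, hqr, fun x => ?_⟩
  · exact mul_nonneg (by positivity) (Finset.sum_nonneg fun σ _ => hp0 _)
  · simp only [q]
    congr 1
    exact Equiv.sum_comp (Equiv.mulLeft σ) fun τ : Equiv.Perm (Fin N) => p (x ∘ τ)
  · by_cases hx : q x = 0
    · simp [hx]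
    have hinj : Function.Injective fun σ : Equiv.Perm (Fin N) => x ∘ σ := by
      have hxi : Function.Injective x := fun j k hjk => by
        by_contra hne
        exact hqr x hx j k hne (hjk ▸ hrefl _)
      intro σ τ h
      ext k
      exact congrArg Fin.val (hxi (congrFun h k))
    simp only [q]
    rw [mul_inv_cancel_left₀ hf.ne', ← hsum, ← Finset.sum_image (f := p) (g := fun σ :
      Equiv.Perm (Fin N) => x ∘ σ) (s := Finset.univ) (fun a _ b _ h => hinj h)]
    exact Finset.sum_le_sum_of_subset_of_nonneg (Finset.subset_univ _) fun y _ _ => hp0 y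

/-! ### Dyadic cubes and their neighbourhoods -/

/-- The index of the dyadic cube of side `2 ^ (-k)` that contains `x`. -/
def gridIdx {d : ℕ} (k : ℤ) (x : E d) : Fin d → ℤ := fun i => ⌊x i * (2 : ℝ) ^ k⌋

/-- The cube of side `3 · 2 ^ (-k)` formed by the dyadic cube of `x` and those adjacent to it. -/
def nbhd {d : ℕ} (k : ℤ) (x : E d) : Set (E d) :=
  {y | ∀ i, |gridIdx k y i - gridIdx k x i| ≤ 1}

section

variable {d : ℕ}

theorem measurable_gridIdx (k : ℤ) : Measurable (gridIdx k : E d → Fin d → ℤ) := by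
  refine measurable_pi_lambda _ fun i => ?_
  have : Measurable fun x : E d => x i * (2 : ℝ) ^ k :=
    ((EuclideanSpace.proj (𝕜 := ℝ) i).continuous.mul continuous_const).measurable
  exact this.floor

theorem measurableSet_nbhd (k : ℤ) (x : E d) : MeasurableSet (nbhd k x) :=
  measurable_gridIdx k (Set.to_countable {n : Fin d → ℤ | ∀ i, |n i - gridIdx k x i| ≤ 1}).measurableSet

theorem gridIdx_eq_ediv (k : ℤ) (x : E d) (i : Fin d) :
    gridIdx k x i = gridIdx (k + 1) x i / 2 := by
  have h := Int.floor_div_natCast (x i * (2 : ℝ) ^ (k + 1)) 2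
  rw [zpow_add_one₀ two_ne_zero] at h
  simp only [gridIdx]
  rw [zpow_add_one₀ two_ne_zero]
  push_cast at h
  rw [← h]
  congr 1
  ring

theorem mem_nbhd_self (k : ℤ) (x : E d) : x ∈ nbhd k x := fun i => by simp

theorem mem_nbhd_comm {k : ℤ} {x y : E d} : y ∈ nbhd k x ↔ x ∈ nbhd k y := by
  refine forall_congr' fun i => ?_
  rw [abs_sub_comm]

theorem nbhd_succ_subset (k : ℤ) (x : E d) : nbhd (k + 1) x ⊆ nbhd k x := by
  intro y hy i
  have h := abs_le.1 (hy i)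
  rw [gridIdx_eq_ediv, gridIdx_eq_ediv k x, abs_le]
  omega

theorem nbhd_antitone (x : E d) : Antitone fun k => nbhd k x :=
  antitone_int_of_succ_le fun k => nbhd_succ_subset k x

/-- Points adjacent at the scale `k + 1` have, at that scale, a neighbourhood contained in the
neighbourhood at the scale `k` of each other. -/
theorem nbhd_succ_subset_of_mem {k : ℤ} {x y : E d} (h : y ∈ nbhd (k + 1) x) :
    nbhd (k + 1) y ⊆ nbhd k x := by
  intro z hz i
  have h1 := abs_le.1 (h i)
  have h2 := abs_le.1 (hz i)
  rw [gridIdx_eq_ediv, gridIdx_eq_ediv k x, abs_le]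
  omega

theorem gridIdx_congr_of_le {k l : ℤ} (hkl : k ≤ l) {x y : E d} (h : gridIdx l x = gridIdx l y) :
    gridIdx k x = gridIdx k y := by
  induction l, hkl using Int.leInduction with
  | base => exact h
  | succ l _ ih =>
    refine ih ?_
    ext i
    rw [gridIdx_eq_ediv, gridIdx_eq_ediv l y, h]

theorem abs_sub_lt_of_mem_nbhd {k : ℤ} {x y : E d} (h : y ∈ nbhd k x) (i : Fin d) :
    |y i - x i| < 2 * (2 : ℝ) ^ (-k) := by
  have hk : (0 : ℝ) < 2 ^ k := by positivity
  have h1 := abs_le.1 (h i)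
  simp only [gridIdx] at h1
  have a1 := Int.floor_le (y i * (2 : ℝ) ^ k)
  have a2 := Int.lt_floor_add_one (y i * (2 : ℝ) ^ k)
  have b1 := Int.floor_le (x i * (2 : ℝ) ^ k)
  have b2 := Int.lt_floor_add_one (x i * (2 : ℝ) ^ k)
  have h2 : ((⌊y i * (2 : ℝ) ^ k⌋ : ℝ)) - ⌊x i * (2 : ℝ) ^ k⌋ ≤ 1 := by exact_mod_cast h1.2
  have h3 : (-1 : ℝ) ≤ (⌊y i * (2 : ℝ) ^ k⌋ : ℝ) - ⌊x i * (2 : ℝ) ^ k⌋ := by exact_mod_cast h1.1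
  have h4 : |y i - x i| * 2 ^ k < 2 := by
    have h5 : |y i - x i| * 2 ^ k = |(y i - x i) * 2 ^ k| := by rw [abs_mul, abs_of_pos hk]
    rw [h5, abs_lt]
    constructor <;> nlinarith
  rw [zpow_neg, ← div_eq_mul_inv, lt_div_iff₀ hk]
  exact h4

theorem norm_coord_le (z : E d) (i : Fin d) : |z i| ≤ ‖z‖ := by
  simpa using PiLp.norm_apply_le z i

theorem ball_subset_nbhd (k : ℤ) (x : E d) : Metric.ball x ((2 : ℝ) ^ (-k)) ⊆ nbhd k x := by
  intro y hy i
  have hk : (0 : ℝ) < 2 ^ k := by positivity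
  have h1 : |y i - x i| < 2 ^ (-k) := by
    have := norm_coord_le (y - x) i
    rw [← dist_eq_norm] at this
    exact this.trans_lt (Metric.mem_ball.1 hy)
  have h2 : |(y i - x i) * 2 ^ k| < 1 := by
    rw [abs_mul, abs_of_pos hk]
    rwa [zpow_neg, ← one_div, lt_div_iff₀ hk] at h1
  have h3 := abs_lt.1 h2
  have a1 := Int.floor_le (y i * (2 : ℝ) ^ k)
  have a2 := Int.lt_floor_add_one (y i * (2 : ℝ) ^ k)
  have b1 := Int.floor_le (x i * (2 : ℝ) ^ k)
  have b2 := Int.lt_floor_add_one (x i * (2 : ℝ) ^ k)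
  simp only [gridIdx]
  have h4 : (⌊y i * (2 : ℝ) ^ k⌋ : ℝ) - ⌊x i * (2 : ℝ) ^ k⌋ < 2 := by nlinarith
  have h5 : (-2 : ℝ) < (⌊y i * (2 : ℝ) ^ k⌋ : ℝ) - ⌊x i * (2 : ℝ) ^ k⌋ := by nlinarith
  have h6 : ⌊y i * (2 : ℝ) ^ k⌋ - ⌊x i * (2 : ℝ) ^ k⌋ < 2 := by exact_mod_cast h4
  have h7 : -2 < ⌊y i * (2 : ℝ) ^ k⌋ - ⌊x i * (2 : ℝ) ^ k⌋ := by exact_mod_cast h5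
  rw [abs_le]
  omega

/-- A lower bound for the distance of points in dyadic cubes that are far apart, in terms of the
difference of the indices. -/
theorem le_norm_sub_of_gridIdx {k : ℤ} {x y : E d} {i : Fin d} {M : ℤ} (hM : 2 ≤ M)
    (h : M ≤ |gridIdx k x i - gridIdx k y i|) : (M : ℝ) / 2 * 2 ^ (-k) ≤ ‖x - y‖ := by
  have hk : (0 : ℝ) < 2 ^ k := by positivity
  refine le_trans ?_ (norm_coord_le (x - y) i)
  have a1 := Int.floor_le (y i * (2 : ℝ) ^ k)
  have a2 := Int.lt_floor_add_one (y i * (2 : ℝ) ^ k)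
  have b1 := Int.floor_le (x i * (2 : ℝ) ^ k)
  have b2 := Int.lt_floor_add_one (x i * (2 : ℝ) ^ k)
  have hM' : (2 : ℝ) ≤ M := by exact_mod_cast hM
  have h1 : (M : ℝ) / 2 ≤ |(x i - y i) * 2 ^ k| := by
    simp only [gridIdx] at h
    rcases le_abs.1 h with h | h
    · have h' : (M : ℝ) ≤ (⌊x i * (2 : ℝ) ^ k⌋ : ℝ) - ⌊y i * (2 : ℝ) ^ k⌋ := by exact_mod_cast h
      exact le_trans (by linarith) (le_abs_self _)
    · have h' : (M : ℝ) ≤ -((⌊x i * (2 : ℝ) ^ k⌋ : ℝ) - ⌊y i * (2 : ℝ) ^ k⌋) := by exact_mod_cast h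
      exact le_trans (by linarith) (neg_le_abs _)
  rw [abs_mul, abs_of_pos hk] at h1
  rw [zpow_neg, ← div_eq_mul_inv, div_le_iff₀ hk]
  exact h1

theorem exists_volume_nbhd_le (hd : 1 ≤ d) : ∃ V : ℝ, 1 ≤ V ∧ ∀ (k : ℤ) (x : E d),
    volume (nbhd k x) ≤ ENNReal.ofReal (V * ((2 : ℝ) ^ (-k)) ^ d) := by
  have hb : volume (Metric.ball (0 : E d) 1) ≠ ∞ := measure_ball_lt_top.ne
  let b := (volume (Metric.ball (0 : E d) 1)).toReal
  refine ⟨max 1 ((Real.sqrt d * 2) ^ d * b), le_max_left _ _, fun k x => ?_⟩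
  have hsub : nbhd k x ⊆ Metric.closedBall x (Real.sqrt d * 2 * 2 ^ (-k)) := by
    intro y hy
    rw [Metric.mem_closedBall, dist_eq_norm, EuclideanSpace.norm_eq]
    refine Real.sqrt_le_iff.2 ⟨by positivity, ?_⟩
    calc ∑ i, ‖(y - x) i‖ ^ 2 ≤ ∑ i : Fin d, (2 * (2 : ℝ) ^ (-k)) ^ 2 := by
          refine Finset.sum_le_sum fun i _ => ?_
          have := abs_sub_lt_of_mem_nbhd hy i
          exact pow_le_pow_left₀ (norm_nonneg _) this.le 2
      _ = _ := by
          simp only [Finset.sum_const, Finset.card_univ, Fintype.card_fin, nsmul_eq_mul]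
          rw [mul_assoc, mul_pow (Real.sqrt d), Real.sq_sqrt (Nat.cast_nonneg d)]
  refine (measure_mono hsub).trans ?_
  rw [Measure.addHaar_closedBall volume x (by positivity), finrank_euclideanSpace_fin,
    ← ENNReal.ofReal_toReal hb, ← ENNReal.ofReal_mul (by positivity)]
  refine ENNReal.ofReal_le_ofReal ?_
  calc (Real.sqrt d * 2 * 2 ^ (-k)) ^ d * b = ((Real.sqrt d * 2) ^ d * b) * ((2 : ℝ) ^ (-k)) ^ d := by
        rw [mul_pow]; ring
    _ ≤ _ := by gcongr; exact le_max_right _ _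

/-! ### The local scale of a measure -/

/-- A finite measure of total mass more than `1 / 4` that gives mass at most `1 / 4` to all
neighbourhoods of a sufficiently small scale. -/
structure IsTame (ν : Measure (E d)) : Prop where
  finite : IsFiniteMeasure ν
  exists_light : ∃ K, ∀ x, ν (nbhd K x) ≤ 1 / 4
  mass : 1 / 4 < ν Set.univ

/-- The local scale of `ν` at `x`: the least `k` such that the neighbourhood of `x` of side
`3 · 2 ^ (-k)` has mass at most `1 / 4`. -/
def scale (ν : Measure (E d)) (x : E d) : ℤ := sInf {k | ν (nbhd k x) ≤ 1 / 4}

namespace IsTame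

variable {ν : Measure (E d)}

theorem exists_heavy (h : IsTame ν) (x : E d) : ∃ k, 1 / 4 < ν (nbhd k x) := by
  have hun : (⋃ n : ℕ, nbhd (-(n : ℤ)) x) = Set.univ := by
    refine Set.eq_univ_of_forall fun y => ?_
    obtain ⟨n, hn⟩ := pow_unbounded_of_one_lt (dist y x) (one_lt_two (α := ℝ))
    exact Set.mem_iUnion.2 ⟨n, ball_subset_nbhd _ _ (by simpa using hn)⟩
  have hmono : Monotone fun n : ℕ => nbhd (-(n : ℤ)) x := fun m n hmn =>
    nbhd_antitone x (by simpa using hmn)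
  have := tendsto_measure_iUnion_atTop (μ := ν) hmono
  rw [hun] at this
  obtain ⟨n, hn⟩ := (this.eventually (lt_mem_nhds h.mass)).exists
  exact ⟨_, hn⟩

theorem bddBelow (h : IsTame ν) (x : E d) : BddBelow {k | ν (nbhd k x) ≤ 1 / 4} := by
  obtain ⟨k, hk⟩ := h.exists_heavy x
  refine ⟨k, fun l hl => ?_⟩
  by_contra! hlt
  exact absurd (hk.trans_le (measure_mono (nbhd_antitone x hlt.le))) (not_lt.2 hl)

theorem measure_nbhd_scale_le (h : IsTame ν) (x : E d) : ν (nbhd (scale ν x) x) ≤ 1 / 4 := by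
  obtain ⟨K, hK⟩ := h.exists_light
  exact Int.csInf_mem (s := {k | ν (nbhd k x) ≤ 1 / 4}) ⟨K, hK x⟩ (h.bddBelow x)

theorem scale_le_iff (h : IsTame ν) (x : E d) (k : ℤ) : scale ν x ≤ k ↔ ν (nbhd k x) ≤ 1 / 4 :=
  ⟨fun hk => (measure_mono (nbhd_antitone x hk)).trans (h.measure_nbhd_scale_le x),
    fun hk => csInf_le (h.bddBelow x) hk⟩

theorem lt_scale_iff (h : IsTame ν) (x : E d) (k : ℤ) : k < scale ν x ↔ 1 / 4 < ν (nbhd k x) := by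
  rw [← not_le, h.scale_le_iff, not_le]

theorem measurable_scale (h : IsTame ν) : Measurable (scale ν) := by
  refine measurable_of_Iic fun k => ?_
  have : scale ν ⁻¹' Set.Iic k =
      gridIdx k ⁻¹' {n | ν {y | ∀ i, |gridIdx k y i - n i| ≤ 1} ≤ 1 / 4} := by
    ext x
    exact h.scale_le_iff x k
  rw [this]
  exact measurable_gridIdx k (Set.to_countable _).measurableSet

end IsTame

theorem isTame_withDensity (hd : 1 ≤ d) {g : E d → ℝ≥0∞} (h1 : 1 / 4 < ∫⁻ x, g x)
    (h2 : ∫⁻ x, g x ≠ ∞) : IsTame (volume.withDensity g) := by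
  refine ⟨isFiniteMeasure_withDensity h2, ?_, by
    rwa [withDensity_apply _ MeasurableSet.univ, Measure.restrict_univ]⟩
  obtain ⟨V, hV, hvol⟩ := exists_volume_nbhd_le hd
  obtain ⟨δ, hδ, hs⟩ := exists_pos_setLIntegral_lt_of_measure_lt h2 (ε := 1 / 4) (by simp)
  have hlim : Tendsto (fun n : ℕ => ENNReal.ofReal (V * ((2 : ℝ) ^ (-(n : ℤ))) ^ d)) atTop (𝓝 0) := by
    rw [← ENNReal.ofReal_zero]
    refine ENNReal.tendsto_ofReal ?_
    have h3 : Tendsto (fun n : ℕ => (((1 / 2 : ℝ)) ^ n) ^ d) atTop (𝓝 (0 ^ d)) :=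
      (tendsto_pow_atTop_nhds_zero_of_lt_one (by norm_num) (by norm_num)).pow d
    rw [zero_pow (by omega)] at h3
    simpa [zpow_neg] using h3.const_mul V
  obtain ⟨n, hn⟩ := (hlim.eventually (gt_mem_nhds hδ)).exists
  refine ⟨n, fun x => ?_⟩
  rw [withDensity_apply _ (measurableSet_nbhd _ _)]
  exact (hs _ ((hvol _ _).trans_lt hn)).le

/-! ### Pieces and the relation of being near -/

/-- The label of the piece that contains `x`: its local scale `k` and the index of its dyadic cube
of side `2 ^ (-(k + 1))`. -/
def piece (ν : Measure (E d)) (x : E d) : ℤ × (Fin d → ℤ) :=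
  (scale ν x, gridIdx (scale ν x + 1) x)

/-- Two points are near if their dyadic cubes are equal or adjacent, at half the side that belongs
to the coarser of the two local scales. This depends on the pieces of the points only. -/
def IsNear (ν : Measure (E d)) (x y : E d) : Prop :=
  y ∈ nbhd (min (scale ν x) (scale ν y) + 1) x

/-- The mass of the piece that contains `x`. -/
def pieceMass (ν : Measure (E d)) (x : E d) : ℝ≥0∞ := ν {y | piece ν y = piece ν x}

theorem IsNear.refl (ν : Measure (E d)) (x : E d) : IsNear ν x x := mem_nbhd_self _ _

theorem IsNear.symm {ν : Measure (E d)} {x y : E d} (h : IsNear ν x y) : IsNear ν y x := by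
  unfold IsNear at h ⊢
  rw [min_comm]
  exact mem_nbhd_comm.1 h

theorem IsNear.congr {ν : Measure (E d)} {x y x' y' : E d} (h : IsNear ν x y)
    (hx : piece ν x = piece ν x') (hy : piece ν y = piece ν y') : IsNear ν x' y' := by
  obtain ⟨hx1, hx2⟩ := Prod.ext_iff.1 hx
  obtain ⟨hy1, hy2⟩ := Prod.ext_iff.1 hy
  simp only [piece] at hx1 hx2 hy1 hy2
  unfold IsNear at h ⊢
  rw [← hx1, ← hy1]
  have e1 := gridIdx_congr_of_le (k := min (scale ν x) (scale ν y) + 1)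
    (add_le_add_left (min_le_left _ _) 1) (hx2.trans (by rw [hx1]))
  have e2 := gridIdx_congr_of_le (k := min (scale ν x) (scale ν y) + 1)
    (add_le_add_left (min_le_right _ _) 1) (hy2.trans (by rw [hy1]))
  intro i
  rw [← e1, ← e2]
  exact h i

theorem IsNear.scale_le {ν : Measure (E d)} (hν : IsTame ν) {x y : E d} (h : IsNear ν x y) :
    scale ν y ≤ scale ν x + 1 := by
  rcases le_total (scale ν y) (scale ν x) with hle | hle
  · omega
  · unfold IsNear at h
    rw [min_eq_left hle] at h
    rw [hν.scale_le_iff]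
    exact (measure_mono (nbhd_succ_subset_of_mem h)).trans (hν.measure_nbhd_scale_le x)

theorem IsNear.mem_nbhd {ν : Measure (E d)} (hν : IsTame ν) {x y : E d} (h : IsNear ν x y) :
    y ∈ nbhd (scale ν x) x := by
  have h1 := h.symm.scale_le hν
  exact nbhd_antitone x (show scale ν x ≤ min (scale ν x) (scale ν y) + 1 by omega) h

theorem IsTame.measurable_piece {ν : Measure (E d)} (hν : IsTame ν) : Measurable (piece ν) := by
  refine measurable_to_countable' fun ⟨k, n⟩ => ?_
  have : piece ν ⁻¹' {(k, n)} = scale ν ⁻¹' {k} ∩ gridIdx (k + 1) ⁻¹' {n} := by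
    ext x
    simp only [piece, Set.mem_preimage, Set.mem_singleton_iff, Prod.mk.injEq, Set.mem_inter_iff]
    constructor
    · rintro ⟨h1, h2⟩
      exact ⟨h1, by rw [← h2, h1]⟩
    · rintro ⟨h1, h2⟩
      exact ⟨h1, by rw [← h2, h1]⟩
  rw [this]
  exact (hν.measurable_scale (measurableSet_singleton k)).inter
    (measurable_gridIdx _ (measurableSet_singleton n))

theorem IsTame.measurable_pieceMass {ν : Measure (E d)} (hν : IsTame ν) :
    Measurable (pieceMass ν) :=
  (measurable_of_countable fun p => ν {y | piece ν y = p}).comp hν.measurable_piece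

theorem IsTame.pieceMass_le {ν : Measure (E d)} (hν : IsTame ν) (x : E d) :
    pieceMass ν x ≤ 1 / 4 := by
  refine (measure_mono fun y hy => ?_).trans (hν.measure_nbhd_scale_le x)
  exact ((IsNear.refl ν x).congr rfl hy.symm).mem_nbhd hν

/-! ### Counting pieces of a given scale -/

theorem lintegral_inv_measure_fiber_le {X ι : Type*} [MeasurableSpace X] {ν : Measure X}
    [IsFiniteMeasure ν] {f : X → ι} (i : ι) (hm : MeasurableSet {x | f x = i}) :
    ∫⁻ x in {x | f x = i}, (ν {y | f y = f x})⁻¹ ∂ν ≤ 1 := by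
  have : ∫⁻ x in {x | f x = i}, (ν {y | f y = f x})⁻¹ ∂ν
      = ∫⁻ x in {x | f x = i}, (ν {y | f y = i})⁻¹ ∂ν := by
    refine setLIntegral_congr_fun hm fun x hx => ?_
    simp only [show f x = i from hx]
  rw [this, lintegral_const, Measure.restrict_apply_univ]
  exact ENNReal.inv_mul_le_one _

/-- A neighbourhood of side `3 · 2 ^ (-(k - 1))` meets at most `12 ^ d` pieces of scale `k`. -/
theorem lintegral_inv_pieceMass_nbhd_le {ν : Measure (E d)} (hν : IsTame ν) (k : ℤ) (y : E d) :
    ∫⁻ x in {x | scale ν x = k} ∩ nbhd (k - 1) y, (pieceMass ν x)⁻¹ ∂ν ≤ 12 ^ d := by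
  have := hν.finite
  -- `3` cubes of side `2 ^ (-(k - 1))` in each direction, each cut into `4`
  let F : Finset (Fin d → ℤ) := Fintype.piFinset fun i =>
    Finset.Icc (4 * (gridIdx (k - 1) y i - 1)) (4 * (gridIdx (k - 1) y i + 1) + 3)
  have hF : F.card = 12 ^ d := by
    have : ∀ a : ℤ, (Finset.Icc (4 * (a - 1)) (4 * (a + 1) + 3)).card = 12 := by
      intro a
      rw [Int.card_Icc]
      omega
    simp only [F, Fintype.card_piFinset, this, Finset.prod_const, Finset.card_univ, Fintype.card_fin]
  have hsub : {x | scale ν x = k} ∩ nbhd (k - 1) y ⊆ ⋃ n ∈ F, {x | piece ν x = (k, n)} := by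
    rintro x ⟨hx1, hx2⟩
    have hx1 : scale ν x = k := hx1
    simp only [Set.mem_iUnion]
    refine ⟨gridIdx (k + 1) x, ?_, by simp [piece, hx1]⟩
    rw [Fintype.mem_piFinset]
    intro i
    have h1 := abs_le.1 (hx2 i)
    have h2 := gridIdx_eq_ediv (k - 1) x i
    have h3 := gridIdx_eq_ediv k x i
    rw [sub_add_cancel] at h2
    rw [Finset.mem_Icc]
    omega
  calc _ ≤ ∫⁻ x in ⋃ n ∈ F, {x | piece ν x = (k, n)}, (pieceMass ν x)⁻¹ ∂ν :=
        lintegral_mono_set hsub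
    _ ≤ ∑ n ∈ F, ∫⁻ x in {x | piece ν x = (k, n)}, (pieceMass ν x)⁻¹ ∂ν := by
        rw [← Finset.sum_coe_sort F fun n => ∫⁻ x in {x | piece ν x = (k, n)}, (pieceMass ν x)⁻¹ ∂ν]
        have : (⋃ n ∈ F, {x | piece ν x = (k, n)}) = ⋃ n : F, {x | piece ν x = (k, n.1)} := by
          ext; simp
        rw [this]
        exact (lintegral_iUnion_le _ _).trans (tsum_fintype _).le
    _ ≤ ∑ n ∈ F, 1 := Finset.sum_le_sum fun n _ => lintegral_inv_measure_fiber_le (k, n)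
        (hν.measurable_piece (measurableSet_singleton _))
    _ = 12 ^ d := by simp [hF]

/-- The density `g` where it exceeds the threshold `c · 2 ^ (k d)`. -/
def upperPart (c : ℝ) (k : ℤ) (g : E d → ℝ≥0∞) : E d → ℝ≥0∞ :=
  {y | ENNReal.ofReal (c * ((2 : ℝ) ^ k) ^ d) < g y}.indicator g

theorem measurable_upperPart {g : E d → ℝ≥0∞} (hg : Measurable g) (c : ℝ) (k : ℤ) :
    Measurable (upperPart c k g) :=
  hg.indicator (measurableSet_lt measurable_const hg)

/-- Neighbourhoods that are not light contain a definite mass of the part of the density above a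
multiple of the inverse volume. -/
theorem exists_one_le_lintegral_upperPart (hd : 1 ≤ d) : ∃ c : ℝ, 0 < c ∧ c ≤ 1 ∧
    ∀ (g : E d → ℝ≥0∞), Measurable g → ∀ (k : ℤ) (x : E d),
      1 / 4 < volume.withDensity g (nbhd (k - 1) x) →
      1 ≤ 8 * ∫⁻ y in nbhd (k - 1) x, upperPart c k g y := by
  obtain ⟨V, hV, hvol⟩ := exists_volume_nbhd_le hd
  have hV0 : 0 < V := by linarith
  refine ⟨1 / (8 * V * 2 ^ d), by positivity, ?_, fun g hg k x hx => ?_⟩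
  · rw [div_le_one (by positivity)]
    nlinarith [one_le_pow₀ (one_le_two (α := ℝ)) (n := d)]
  set c := 1 / (8 * V * 2 ^ d) with hc
  have h1 : volume.withDensity g (nbhd (k - 1) x) ≤
      (∫⁻ y in nbhd (k - 1) x, upperPart c k g y) + 1 / 8 := by
    rw [withDensity_apply _ (measurableSet_nbhd _ _)]
    have : ∀ y, g y ≤ upperPart c k g y + ENNReal.ofReal (c * ((2 : ℝ) ^ k) ^ d) := by
      intro y
      by_cases h : ENNReal.ofReal (c * ((2 : ℝ) ^ k) ^ d) < g y
      · rw [upperPart, Set.indicator_of_mem (by exact h)]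
        exact le_self_add
      · exact (not_lt.1 h).trans le_add_self
    refine (lintegral_mono this).trans ?_
    rw [lintegral_add_right _ measurable_const, lintegral_const, Measure.restrict_apply_univ]
    refine add_le_add le_rfl ?_
    refine (mul_le_mul_right (hvol (k - 1) x) _).trans ?_
    rw [← ENNReal.ofReal_mul (by positivity)]
    have : c * ((2 : ℝ) ^ k) ^ d * (V * ((2 : ℝ) ^ (-(k - 1))) ^ d) = 1 / 8 := by
      have e1 : (2 : ℝ) ^ (-(k - 1)) = 2 * (2 ^ k)⁻¹ := by
        rw [neg_sub, sub_eq_add_neg, zpow_add₀ two_ne_zero, zpow_neg, zpow_one]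
      rw [e1, hc, mul_pow, inv_pow]
      field_simp
    rw [this, ENNReal.ofReal_div_of_pos (by norm_num)]
    simp
  by_contra! hcon
  have h2 : ∫⁻ y in nbhd (k - 1) x, upperPart c k g y ≤ 1 / 8 := by
    rw [ENNReal.le_div_iff_mul_le (by simp) (by simp), mul_comm]
    exact hcon.le
  have h3 : (1 / 4 : ℝ≥0∞) < 1 / 8 + 1 / 8 := hx.trans_le (h1.trans (add_le_add h2 le_rfl))
  have h4 : (1 / 8 + 1 / 8 : ℝ≥0∞) = 1 / 4 := by
    rw [← ENNReal.toReal_eq_toReal_iff' (by finiteness) (by finiteness)]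
    rw [ENNReal.toReal_add (by finiteness) (by finiteness)]
    norm_num
  exact h3.ne' h4

/-- The number of pieces of scale `k` is controlled by the mass of the density above a multiple of
`2 ^ (k d)`: the neighbourhood of such a piece at the next coarser scale is not light, and these
neighbourhoods have bounded overlap. -/
theorem exists_lintegral_inv_pieceMass_le (hd : 1 ≤ d) : ∃ c : ℝ, 0 < c ∧ c ≤ 1 ∧
    ∀ (g : E d → ℝ≥0∞), Measurable g → IsTame (volume.withDensity g) → ∀ k : ℤ,
      ∫⁻ x in {x | scale (volume.withDensity g) x = k},
        (pieceMass (volume.withDensity g) x)⁻¹ ∂(volume.withDensity g)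
        ≤ 8 * 12 ^ d * ∫⁻ y, upperPart c k g y := by
  obtain ⟨c, hc0, hc1, hc⟩ := exists_one_le_lintegral_upperPart (d := d) hd
  refine ⟨c, hc0, hc1, fun g hg hν k => ?_⟩
  set ν := volume.withDensity g with hνdef
  have := hν.finite
  have hD : MeasurableSet {x | scale ν x = k} := hν.measurable_scale (measurableSet_singleton k)
  have hMm : Measurable fun x => (pieceMass ν x)⁻¹ := hν.measurable_pieceMass.inv
  have hu := measurable_upperPart hg c k
  have hN : MeasurableSet {p : E d × E d | p.2 ∈ nbhd (k - 1) p.1} := by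
    have h1 : Measurable fun p : E d × E d => (gridIdx (k - 1) p.1, gridIdx (k - 1) p.2) :=
      ((measurable_gridIdx _).comp measurable_fst).prodMk
        ((measurable_gridIdx _).comp measurable_snd)
    exact h1 (Set.to_countable {q : (Fin d → ℤ) × (Fin d → ℤ) |
      ∀ i, |q.2 i - q.1 i| ≤ 1}).measurableSet
  let Φ : E d → E d → ℝ≥0∞ := fun x y =>
    (nbhd (k - 1) x).indicator (fun y => (pieceMass ν x)⁻¹ * upperPart c k g y) y
  have hΦ : Measurable (Function.uncurry Φ) :=
    ((hMm.comp measurable_fst).mul (hu.comp measurable_snd)).indicator hN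
  calc ∫⁻ x in {x | scale ν x = k}, (pieceMass ν x)⁻¹ ∂ν
      ≤ ∫⁻ x in {x | scale ν x = k}, 8 * ∫⁻ y, Φ x y ∂volume ∂ν := by
        refine setLIntegral_mono' hD fun x hx => ?_
        have hx : scale ν x = k := hx
        have h1 : 1 ≤ 8 * ∫⁻ y in nbhd (k - 1) x, upperPart c k g y :=
          hc g hg k x ((hν.lt_scale_iff x _).1 (by omega))
        have h2 : ∫⁻ y, Φ x y = (pieceMass ν x)⁻¹ * ∫⁻ y in nbhd (k - 1) x, upperPart c k g y := by
          rw [← lintegral_const_mul _ hu, ← lintegral_indicator (measurableSet_nbhd _ _)]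
        rw [h2, mul_left_comm]
        exact le_mul_of_one_le_right zero_le h1
    _ = 8 * ∫⁻ y, ∫⁻ x in {x | scale ν x = k}, Φ x y ∂ν := by
        have h3 : Measurable fun x => ∫⁻ y, Φ x y := hΦ.lintegral_prod_right'
        rw [lintegral_const_mul _ h3, lintegral_lintegral_swap hΦ.aemeasurable]
    _ ≤ 8 * ∫⁻ y, 12 ^ d * upperPart c k g y := by
        gcongr with y
        have h2 : ∫⁻ x in {x | scale ν x = k}, Φ x y ∂ν = upperPart c k g y *
            ∫⁻ x in {x | scale ν x = k} ∩ nbhd (k - 1) y, (pieceMass ν x)⁻¹ ∂ν := by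
          rw [← lintegral_const_mul _ hMm, Set.inter_comm, ← Measure.restrict_restrict
            (measurableSet_nbhd _ _), ← lintegral_indicator (measurableSet_nbhd _ _)]
          refine lintegral_congr fun x => ?_
          by_cases hxy : x ∈ nbhd (k - 1) y
          · rw [Set.indicator_of_mem hxy, mul_comm]
            exact Set.indicator_of_mem (mem_nbhd_comm.1 hxy) _
          · rw [Set.indicator_of_notMem hxy]
            exact Set.indicator_of_notMem (fun h => hxy (mem_nbhd_comm.1 h)) _
        rw [h2, mul_comm]
        gcongr
        exact lintegral_inv_pieceMass_nbhd_le hν k y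
    _ = _ := by
        rw [lintegral_const_mul _ hu, mul_assoc]

end

/-! ### Sums over dyadic scales -/

/-- A geometric series over the powers `b ^ k` below `t` is bounded by its value at `t`. -/
theorem exists_tsum_zpow_rpow_le {b γ : ℝ} (hb : 1 < b) (hγ : 0 < γ) : ∃ C : ℝ, 0 < C ∧ ∀ t : ℝ,
    ∑' k : ℤ, (if b ^ k < t then ENNReal.ofReal ((b ^ k) ^ γ) else 0) ≤ ENNReal.ofReal (C * t ^ γ) := by
  have hb0 : 0 < b := by linarith
  have hr1 : b ^ (-γ) < 1 := Real.rpow_lt_one_of_one_lt_of_neg hb (by linarith)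
  have hr0 : 0 ≤ b ^ (-γ) := by positivity
  refine ⟨(1 - b ^ (-γ))⁻¹, inv_pos.2 (by linarith), fun t => ?_⟩
  rcases le_or_gt t 0 with ht | ht
  · have : ∀ k : ℤ, ¬ b ^ k < t := fun k => not_lt.2 (ht.trans (by positivity))
    simp [this]
  obtain ⟨n, hn1, hn2⟩ := exists_mem_Ioc_zpow ht hb
  have hinj : Function.Injective fun j : ℕ => n - (j : ℤ) := fun i j h => by
    simpa using h
  have hsupp : Function.support (fun k : ℤ => if b ^ k < t then ENNReal.ofReal ((b ^ k) ^ γ) else 0) ⊆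
      Set.range fun j : ℕ => n - (j : ℤ) := by
    intro k hk
    have hk1 : b ^ k < t := by
      by_contra h
      exact hk (if_neg h)
    have hk2 : k < n + 1 := (zpow_lt_zpow_iff_right₀ hb).1 (hk1.trans_le hn2)
    exact ⟨(n - k).toNat, by simp only []; omega⟩
  rw [← hinj.tsum_eq hsupp]
  calc _ ≤ ∑' j : ℕ, ENNReal.ofReal (t ^ γ) * ENNReal.ofReal (b ^ (-γ)) ^ j := by
        refine ENNReal.tsum_le_tsum fun j => ?_
        refine (ite_le_sup _ _ _).trans (sup_le ?_ zero_le)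
        rw [← ENNReal.ofReal_pow hr0, ← ENNReal.ofReal_mul (by positivity)]
        refine ENNReal.ofReal_le_ofReal ?_
        rw [zpow_sub₀ hb0.ne', Real.div_rpow (by positivity) (by positivity), div_eq_mul_inv]
        gcongr
        rw [Real.rpow_neg hb0.le, inv_pow, zpow_natCast, ← Real.rpow_natCast b j,
          ← Real.rpow_natCast (b ^ γ) j, ← Real.rpow_mul hb0.le, ← Real.rpow_mul hb0.le, mul_comm]
    _ = _ := by
        rw [ENNReal.tsum_mul_left, ENNReal.tsum_geometric, ← ENNReal.ofReal_one,
          ← ENNReal.ofReal_sub _ hr0, ← ENNReal.ofReal_inv_of_pos (by linarith),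
          ← ENNReal.ofReal_mul (by positivity), mul_comm]

/-- The number of powers of `b` in an interval grows with the logarithm of the ratio of its
endpoints; this is the source of the logarithm for `α = d`. -/
theorem tsum_zpow_mem_Ioo_le {b A B : ℝ} (hb : 1 < b) (hA : 0 < A) (hB : 0 < B) :
    ∑' j : ℤ, (if A < b ^ j ∧ b ^ j < B then (1 : ℝ≥0∞) else 0) ≤
      ENNReal.ofReal (1 + max (Real.log (B / A)) 0 / Real.log b) := by
  have hb0 : 0 < b := by linarith
  have hlog : 0 < Real.log b := Real.log_pos hb
  let S : Finset ℤ := Finset.Icc (⌊Real.log A / Real.log b⌋ + 1) ⌊Real.log B / Real.log b⌋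
  have hsupp : ∀ j ∉ S, (if A < b ^ j ∧ b ^ j < B then (1 : ℝ≥0∞) else 0) = 0 := by
    intro j hj
    refine if_neg fun h => hj ?_
    have h1 := Real.log_lt_log hA h.1
    have h2 := Real.log_lt_log (by positivity) h.2
    rw [Real.log_zpow] at h1 h2
    rw [Finset.mem_Icc]
    refine ⟨?_, ?_⟩
    · rw [Int.add_one_le_iff, Int.floor_lt, div_lt_iff₀ hlog]
      exact h1
    · rw [Int.le_floor, le_div_iff₀ hlog]
      exact h2.le
  rw [tsum_eq_sum hsupp]
  calc _ ≤ ∑ j ∈ S, (1 : ℝ≥0∞) := Finset.sum_le_sum fun j _ => by split_ifs <;> simp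
    _ = ENNReal.ofReal (S.card : ℝ) := by simp
    _ ≤ _ := by
      refine ENNReal.ofReal_le_ofReal ?_
      have hm : 0 ≤ max (Real.log (B / A)) 0 / Real.log b := div_nonneg (le_max_right _ _) hlog.le
      simp only [S, Int.card_Icc]
      have h1 := Int.floor_le (Real.log B / Real.log b)
      have h2 := Int.lt_floor_add_one (Real.log A / Real.log b)
      have h3 : Real.log B / Real.log b - Real.log A / Real.log b ≤
          max (Real.log (B / A)) 0 / Real.log b := by
        rw [← sub_div, Real.log_div hB.ne' hA.ne']
        gcongr
        exact le_max_left _ _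
      rcases le_total (⌊Real.log B / Real.log b⌋ + 1 - (⌊Real.log A / Real.log b⌋ + 1)) 0 with h | h
      · rw [Int.toNat_of_nonpos h]
        push_cast
        linarith
      · have h4 : (((⌊Real.log B / Real.log b⌋ + 1 - (⌊Real.log A / Real.log b⌋ + 1)).toNat : ℤ) : ℝ)
            = (⌊Real.log B / Real.log b⌋ + 1 - (⌊Real.log A / Real.log b⌋ + 1) : ℤ) := by
          rw [Int.toNat_of_nonneg h]
        rw [Int.cast_natCast] at h4
        rw [h4]
        push_cast
        linarith

/-- An upper bound for the interaction of a point of local scale `k` with well separated points of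
coarser or equal scale, for a decreasing profile `u`: the `l`-th term bounds the contribution of
the points at distance comparable to `2 ^ (l - k)`. -/
def shellSum (d : ℕ) (u : ℝ → ℝ≥0∞) (k : ℤ) : ℝ≥0∞ :=
  ∑' l : ℕ, ENNReal.ofReal (((2 : ℝ) ^ (l + 2)) ^ d) * u (2 ^ ((l : ℤ) - k - 2))

/-- The sum over the dyadic distances `2 ^ j` larger than `t ^ (-1 / d)` that corresponds to the
integral of `u (|x|)` over `|x| > t ^ (-1 / d)`. -/
def dyadicTail (d : ℕ) (u : ℝ → ℝ≥0∞) (t : ℝ) : ℝ≥0∞ :=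
  ∑' j : ℤ, if ((2 : ℝ) ^ (-j)) ^ d < t then
    ENNReal.ofReal (((2 : ℝ) ^ j) ^ d) * u (2 ^ (j - 2)) else 0

theorem exists_tsum_pow_le {d : ℕ} (hd : 1 ≤ d) : ∃ C : ℝ, 0 < C ∧ ∀ t : ℝ,
    ∑' k : ℤ, (if ((2 : ℝ) ^ k) ^ d < t then ENNReal.ofReal (((2 : ℝ) ^ k) ^ d) else 0) ≤
      ENNReal.ofReal (C * t) := by
  obtain ⟨C, hC, h⟩ := exists_tsum_zpow_rpow_le (b := (2 : ℝ) ^ d)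
    (one_lt_pow₀ one_lt_two (by omega)) one_pos
  refine ⟨C, hC, fun t => ?_⟩
  have e : ∀ k : ℤ, ((2 : ℝ) ^ d) ^ k = ((2 : ℝ) ^ k) ^ d := fun k => by
    rw [← zpow_natCast, ← zpow_natCast, ← zpow_mul, ← zpow_mul, mul_comm]
  simpa only [Real.rpow_one, e] using h t

/-- Summed over the scales `k` with `2 ^ (k d) < t`, the shell sums factorise after the substitution
`j = l - k`, which satisfies `2 ^ (-j d) < t` as well. -/
theorem exists_tsum_shellSum_le {d : ℕ} (hd : 1 ≤ d) : ∃ C : ℝ, 0 < C ∧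
    ∀ (u : ℝ → ℝ≥0∞) (t : ℝ),
      ∑' k : ℤ, (if ((2 : ℝ) ^ k) ^ d < t then shellSum d u k else 0) ≤
        ENNReal.ofReal (C * t) * dyadicTail d u t := by
  obtain ⟨C, hC, h⟩ := exists_tsum_pow_le hd
  refine ⟨4 ^ d * C, by positivity, fun u t => ?_⟩
  let a : ℤ → ℝ≥0∞ := fun k => if ((2 : ℝ) ^ k) ^ d < t then ENNReal.ofReal (((2 : ℝ) ^ k) ^ d) else 0
  let b : ℤ → ℝ≥0∞ := fun j => if ((2 : ℝ) ^ (-j)) ^ d < t then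
    ENNReal.ofReal (((2 : ℝ) ^ j) ^ d) * u (2 ^ (j - 2)) else 0
  have hterm : ∀ k : ℤ, (if ((2 : ℝ) ^ k) ^ d < t then shellSum d u k else 0) ≤
      ENNReal.ofReal (4 ^ d) * (a k * ∑' j, b j) := by
    intro k
    split_ifs with hk
    · have hinj : Function.Injective fun l : ℕ => (l : ℤ) - k := fun i j h => by simpa using h
      refine le_trans ?_ (mul_le_mul_right (mul_le_mul_right
        (ENNReal.tsum_comp_le_tsum_of_injective hinj b) _) _)
      simp only [shellSum, a, if_pos hk]
      rw [← ENNReal.tsum_mul_left, ← ENNReal.tsum_mul_left]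
      refine ENNReal.tsum_le_tsum fun l => ?_
      have h1 : ((2 : ℝ) ^ (-((l : ℤ) - k))) ^ d < t := by
        refine lt_of_le_of_lt ?_ hk
        gcongr
        · exact one_le_two
        · omega
      simp only [b, if_pos h1]
      rw [← mul_assoc, ← mul_assoc, ← ENNReal.ofReal_mul (by positivity),
        ← ENNReal.ofReal_mul (by positivity), ← mul_pow, ← mul_pow, mul_assoc (4 : ℝ),
        ← zpow_add₀ two_ne_zero, add_sub_cancel, zpow_natCast]
      refine le_of_eq ?_
      congr 3
      ring
    · exact zero_le
  calc _ ≤ ∑' k, ENNReal.ofReal (4 ^ d) * (a k * ∑' j, b j) := ENNReal.tsum_le_tsum hterm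
    _ = ENNReal.ofReal (4 ^ d) * ((∑' k, a k) * dyadicTail d u t) := by
        rw [ENNReal.tsum_mul_left, ENNReal.tsum_mul_right]
        rfl
    _ ≤ ENNReal.ofReal (4 ^ d) * (ENNReal.ofReal (C * t) * dyadicTail d u t) := by
        gcongr
        exact h t
    _ = _ := by
        rw [← mul_assoc, ← ENNReal.ofReal_mul (by positivity), mul_assoc]

/-! ### The profile of the potential -/

/-- The upper profile of the potential as a function of the distance. -/
def radialProfile (κ r₀ α s r : ℝ) : ℝ≥0∞ :=
  ENNReal.ofReal κ * ((if r < r₀ then (ENNReal.ofReal r₀ / ENNReal.ofReal r) ^ α else 0) +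
    ENNReal.ofReal (1 / (1 + r ^ s)))

theorem radialProfile_antitoneOn {κ r₀ α s : ℝ} (hα : 0 ≤ α) (hs : 0 ≤ s) :
    AntitoneOn (radialProfile κ r₀ α s) (Set.Ici 0) := by
  intro a ha b hb hab
  have ha : 0 ≤ a := ha
  unfold radialProfile
  gcongr
  split_ifs with h1 h2
  · gcongr
  · exact absurd (hab.trans_lt h1) h2
  · exact zero_le
  · exact le_rfl

/-- The part of the profile that lives in the core `r < r₀`, without the factor `κ`. -/
def coreProfile (r₀ α r : ℝ) : ℝ≥0∞ :=
  if r < r₀ then (ENNReal.ofReal r₀ / ENNReal.ofReal r) ^ α else 0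

theorem dyadicTail_radialProfile {d : ℕ} (κ r₀ α s t : ℝ) :
    dyadicTail d (radialProfile κ r₀ α s) t = ENNReal.ofReal κ *
      (dyadicTail d (coreProfile r₀ α) t +
        dyadicTail d (fun r => ENNReal.ofReal (1 / (1 + r ^ s))) t) := by
  simp only [dyadicTail]
  rw [← ENNReal.tsum_add, ← ENNReal.tsum_mul_left]
  refine tsum_congr fun j => ?_
  split_ifs
  · rw [radialProfile, coreProfile]; ring
  · simp

theorem tsum_comp_neg (b : ℤ → ℝ≥0∞) : ∑' j, b (-j) = ∑' j, b j := (Equiv.neg ℤ).tsum_eq b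

/-- The decay with `s > d` is summable at large distances, and the profile is bounded at small
ones, so the bound does not depend on `t`. -/
theorem exists_dyadicTail_decay_le {d : ℕ} (hd : 1 ≤ d) {s : ℝ} (hs : (d : ℝ) < s) :
    ∃ C : ℝ, 0 < C ∧ ∀ t, dyadicTail d (fun r => ENNReal.ofReal (1 / (1 + r ^ s))) t ≤
      ENNReal.ofReal C := by
  have hd0 : (0 : ℝ) < d := by exact_mod_cast hd
  obtain ⟨C₁, hC₁, h₁⟩ := exists_tsum_zpow_rpow_le (b := 2) (γ := d) one_lt_two hd0
  obtain ⟨C₂, hC₂, h₂⟩ := exists_tsum_zpow_rpow_le (b := 2) (γ := s - d) one_lt_two (by linarith)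
  refine ⟨C₁ * 2 ^ (d : ℝ) + 4 ^ s * (C₂ * 2 ^ (s - d)), by positivity, fun t => ?_⟩
  let a : ℤ → ℝ≥0∞ := fun k => if (2 : ℝ) ^ k < 2 then ENNReal.ofReal (((2 : ℝ) ^ k) ^ (d : ℝ)) else 0
  let b : ℤ → ℝ≥0∞ := fun k => if (2 : ℝ) ^ k < 2 then ENNReal.ofReal (((2 : ℝ) ^ k) ^ (s - d)) else 0
  have hterm : ∀ j : ℤ, (if ((2 : ℝ) ^ (-j)) ^ d < t then ENNReal.ofReal (((2 : ℝ) ^ j) ^ d) *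
      ENNReal.ofReal (1 / (1 + ((2 : ℝ) ^ (j - 2)) ^ s)) else 0) ≤
      a j + ENNReal.ofReal (4 ^ s) * b (-j) := by
    intro j
    refine (ite_le_sup _ _ _).trans (sup_le ?_ zero_le)
    have hj : (0 : ℝ) < 2 ^ j := by positivity
    rw [← ENNReal.ofReal_mul (by positivity)]
    rcases le_or_gt j 0 with hj0 | hj0
    · refine le_trans ?_ le_self_add
      have : (2 : ℝ) ^ j < 2 := by
        refine lt_of_le_of_lt (zpow_le_one_of_nonpos₀ one_le_two hj0) one_lt_two
      simp only [a, if_pos this]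
      refine ENNReal.ofReal_le_ofReal ?_
      rw [Real.rpow_natCast]
      refine mul_le_of_le_one_right (by positivity) ?_
      rw [div_le_one (by positivity)]
      have : (0 : ℝ) < ((2 : ℝ) ^ (j - 2)) ^ s := by positivity
      linarith
    · refine le_trans ?_ le_add_self
      have : (2 : ℝ) ^ (-j) < 2 := by
        refine lt_of_le_of_lt (zpow_le_one_of_nonpos₀ one_le_two (by omega)) one_lt_two
      simp only [b, if_pos this]
      rw [← ENNReal.ofReal_mul (by positivity)]
      refine ENNReal.ofReal_le_ofReal ?_
      have e1 : ((2 : ℝ) ^ (j - 2)) ^ s = ((2 : ℝ) ^ j) ^ s / 4 ^ s := by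
        rw [zpow_sub₀ two_ne_zero, Real.div_rpow hj.le (by positivity)]
        norm_num
      have e2 : ((2 : ℝ) ^ (-j)) ^ (s - d) = ((2 : ℝ) ^ j) ^ d / ((2 : ℝ) ^ j) ^ s := by
        rw [zpow_neg, Real.inv_rpow hj.le, ← Real.rpow_neg hj.le, neg_sub, Real.rpow_sub hj,
          Real.rpow_natCast]
      have hjs : (0 : ℝ) < ((2 : ℝ) ^ j) ^ s := by positivity
      have h4s : (0 : ℝ) < (4 : ℝ) ^ s := by positivity
      calc ((2 : ℝ) ^ j) ^ d * (1 / (1 + ((2 : ℝ) ^ (j - 2)) ^ s))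
          ≤ ((2 : ℝ) ^ j) ^ d * (1 / ((2 : ℝ) ^ (j - 2)) ^ s) := by
            gcongr
            linarith
        _ = _ := by
            rw [e1, e2]
            field_simp
  calc _ ≤ ∑' j, (a j + ENNReal.ofReal (4 ^ s) * b (-j)) := ENNReal.tsum_le_tsum hterm
    _ = ∑' j, a j + ENNReal.ofReal (4 ^ s) * ∑' j, b j := by
        rw [ENNReal.tsum_add, ENNReal.tsum_mul_left, tsum_comp_neg b]
    _ ≤ ENNReal.ofReal (C₁ * 2 ^ (d : ℝ)) +
        ENNReal.ofReal (4 ^ s) * ENNReal.ofReal (C₂ * 2 ^ (s - d)) := by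
        gcongr
        · exact h₁ 2
        · exact h₂ 2
    _ = _ := by
        rw [← ENNReal.ofReal_mul (by positivity), ← ENNReal.ofReal_add (by positivity) (by positivity)]

theorem ofReal_pow_mul_coreProfile_le {d : ℕ} {r₀ α : ℝ} (hr₀ : 0 ≤ r₀) (hα : 0 ≤ α) (j : ℤ) :
    ENNReal.ofReal (((2 : ℝ) ^ j) ^ d) * coreProfile r₀ α (2 ^ (j - 2)) ≤
      if (2 : ℝ) ^ j < 4 * r₀ then
        ENNReal.ofReal ((4 * r₀) ^ α) * ENNReal.ofReal (((2 : ℝ) ^ (-j)) ^ (α - d)) else 0 := by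
  have hj : (0 : ℝ) < 2 ^ j := by positivity
  have e : (2 : ℝ) ^ (j - 2) = 2 ^ j / 4 := by
    rw [zpow_sub₀ two_ne_zero]; norm_num
  have e' : (2 : ℝ) ^ j / 4 < r₀ ↔ (2 : ℝ) ^ j < 4 * r₀ := by
    rw [div_lt_iff₀ (by norm_num), mul_comm r₀]
  simp only [coreProfile, e, e']
  split_ifs with h
  · rw [← ENNReal.ofReal_div_of_pos (by positivity), ENNReal.ofReal_rpow_of_nonneg (by positivity) hα,
      ← ENNReal.ofReal_mul (by positivity), ← ENNReal.ofReal_mul (by positivity)]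
    refine ENNReal.ofReal_le_ofReal (le_of_eq ?_)
    have e1 : r₀ / (2 ^ j / 4) = 4 * r₀ / 2 ^ j := by field_simp
    rw [e1, Real.div_rpow (by positivity) hj.le, zpow_neg, Real.inv_rpow hj.le,
      ← Real.rpow_neg hj.le, neg_sub, Real.rpow_sub hj, Real.rpow_natCast]
    ring
  · simp

theorem exists_dyadicTail_core_le {d : ℕ} (hd : 1 ≤ d) {α : ℝ} (hα : (d : ℝ) < α) :
    ∃ C : ℝ, 0 < C ∧ ∀ r₀ t : ℝ, 0 ≤ r₀ → 0 ≤ t →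
      dyadicTail d (coreProfile r₀ α) t ≤ ENNReal.ofReal (C * r₀ ^ α * t ^ (α / d - 1)) := by
  have hd0 : (0 : ℝ) < d := by exact_mod_cast hd
  obtain ⟨C, hC, h⟩ := exists_tsum_zpow_rpow_le (b := 2) (γ := α - d) one_lt_two (by linarith)
  refine ⟨4 ^ α * C, by positivity, fun r₀ t hr₀ ht => ?_⟩
  let b : ℤ → ℝ≥0∞ := fun k => if (2 : ℝ) ^ k < t ^ (1 / d : ℝ) then
    ENNReal.ofReal (((2 : ℝ) ^ k) ^ (α - d)) else 0
  have hterm : ∀ j : ℤ, (if ((2 : ℝ) ^ (-j)) ^ d < t then ENNReal.ofReal (((2 : ℝ) ^ j) ^ d) *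
      coreProfile r₀ α (2 ^ (j - 2)) else 0) ≤ ENNReal.ofReal ((4 * r₀) ^ α) * b (-j) := by
    intro j
    split_ifs with hj
    · have h1 : (2 : ℝ) ^ (-j) < t ^ (1 / d : ℝ) := by
        rw [one_div, Real.lt_rpow_inv_iff_of_pos (by positivity) ht hd0, Real.rpow_natCast]
        exact hj
      refine (ofReal_pow_mul_coreProfile_le hr₀ (by linarith) j).trans ?_
      simp only [b, if_pos h1]
      exact (ite_le_sup _ _ _).trans (sup_le le_rfl zero_le)
    · exact zero_le
  calc _ ≤ ∑' j, ENNReal.ofReal ((4 * r₀) ^ α) * b (-j) := ENNReal.tsum_le_tsum hterm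
    _ = ENNReal.ofReal ((4 * r₀) ^ α) * ∑' j, b j := by
        rw [ENNReal.tsum_mul_left, tsum_comp_neg b]
    _ ≤ ENNReal.ofReal ((4 * r₀) ^ α) * ENNReal.ofReal (C * (t ^ (1 / d : ℝ)) ^ (α - d)) := by
        gcongr
        exact h _
    _ = _ := by
        rw [← ENNReal.ofReal_mul (by positivity), Real.mul_rpow (by norm_num) hr₀, ← Real.rpow_mul ht]
        have : 1 / (d : ℝ) * (α - d) = α / d - 1 := by field_simp
        rw [this]
        congr 1
        ring

theorem exists_dyadicTail_core_log_le {d : ℕ} (hd : 1 ≤ d) {c : ℝ} (hc0 : 0 < c) (hc1 : c ≤ 1) :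
    ∃ C : ℝ, 0 < C ∧ ∀ r₀ ρ : ℝ, 0 ≤ r₀ → 0 ≤ ρ →
      dyadicTail d (coreProfile r₀ d) (ρ / c) ≤
        ENNReal.ofReal (C * r₀ ^ d) * (1 + ENNReal.ofReal (max (Real.log (r₀ ^ d * ρ)) 0)) := by
  have hb : (1 : ℝ) < 2 ^ d := one_lt_pow₀ one_lt_two (by omega)
  have hL : 0 < Real.log (2 ^ d) := Real.log_pos hb
  set L := Real.log ((2 : ℝ) ^ d)
  have hA0 : 0 ≤ Real.log (4 ^ d / c) := Real.log_nonneg (by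
    rw [le_div_iff₀ hc0, one_mul]
    exact hc1.trans (one_le_pow₀ (by norm_num)))
  set A := Real.log (4 ^ d / c)
  have e : ∀ k : ℤ, ((2 : ℝ) ^ d) ^ k = ((2 : ℝ) ^ k) ^ d := fun k => by
    rw [← zpow_natCast, ← zpow_natCast, ← zpow_mul, ← zpow_mul, mul_comm]
  refine ⟨4 ^ d * (1 + A / L + 1 / L), by positivity, fun r₀ ρ hr₀ hρ => ?_⟩
  rcases hr₀.eq_or_lt with rfl | hr₀'
  · have : dyadicTail d (coreProfile 0 d) (ρ / c) = 0 := by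
      simp only [dyadicTail, ENNReal.tsum_eq_zero]
      intro j
      have : ¬ (2 : ℝ) ^ (j - 2) < 0 := not_lt.2 (by positivity)
      simp [coreProfile, this]
    rw [this]
    exact zero_le
  rcases hρ.eq_or_lt with rfl | hρ'
  · have : dyadicTail d (coreProfile r₀ d) (0 / c) = 0 := by
      simp only [dyadicTail, ENNReal.tsum_eq_zero]
      intro j
      have : ¬ ((2 : ℝ) ^ (-j)) ^ d < 0 / c := not_lt.2 (by rw [zero_div]; positivity)
      rw [if_neg this]
    rw [this]
    exact zero_le
  have hterm : ∀ j : ℤ, (if ((2 : ℝ) ^ (-j)) ^ d < ρ / c then ENNReal.ofReal (((2 : ℝ) ^ j) ^ d) *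
      coreProfile r₀ d (2 ^ (j - 2)) else 0) ≤ ENNReal.ofReal ((4 * r₀) ^ d) *
        (if (ρ / c)⁻¹ < ((2 : ℝ) ^ d) ^ j ∧ ((2 : ℝ) ^ d) ^ j < (4 * r₀) ^ d then 1 else 0) := by
    intro j
    split_ifs with hj hj' hj'
    · refine (ofReal_pow_mul_coreProfile_le hr₀ (Nat.cast_nonneg d) j).trans ?_
      refine (ite_le_sup _ _ _).trans (sup_le ?_ zero_le)
      simp
    · refine (ofReal_pow_mul_coreProfile_le hr₀ (Nat.cast_nonneg d) j).trans ?_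
      rw [if_neg]
      · exact zero_le
      · intro h
        refine hj' ⟨?_, ?_⟩
        · rw [e, inv_lt_comm₀ (by positivity) (by positivity), ← inv_pow, ← zpow_neg]
          exact hj
        · rw [e]
          exact pow_lt_pow_left₀ h (by positivity) (by omega)
    · exact zero_le
    · exact zero_le
  calc _ ≤ ENNReal.ofReal ((4 * r₀) ^ d) * ∑' j : ℤ,
        (if (ρ / c)⁻¹ < ((2 : ℝ) ^ d) ^ j ∧ ((2 : ℝ) ^ d) ^ j < (4 * r₀) ^ d then 1 else 0) := by
        rw [← ENNReal.tsum_mul_left]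
        exact ENNReal.tsum_le_tsum hterm
    _ ≤ ENNReal.ofReal ((4 * r₀) ^ d) *
        ENNReal.ofReal (1 + max (Real.log ((4 * r₀) ^ d / (ρ / c)⁻¹)) 0 / L) := by
        gcongr
        exact tsum_zpow_mem_Ioo_le hb (by positivity) (by positivity)
    _ ≤ _ := by
        rw [← ENNReal.ofReal_one, ← ENNReal.ofReal_add zero_le_one (le_max_right _ _),
          ← ENNReal.ofReal_mul (by positivity), ← ENNReal.ofReal_mul (by positivity)]
        refine ENNReal.ofReal_le_ofReal ?_
        have h1 : (4 * r₀) ^ d / (ρ / c)⁻¹ = (r₀ ^ d * ρ) * (4 ^ d / c) := by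
          rw [mul_pow]; field_simp
        rw [h1, Real.log_mul (by positivity) (by positivity)]
        set m := max (Real.log (r₀ ^ d * ρ)) 0
        have hm : 0 ≤ m := le_max_right _ _
        have h2 : max (Real.log (r₀ ^ d * ρ) + A) 0 ≤ m + A :=
          max_le (by gcongr; exact le_max_left _ _) (by positivity)
        have h3 : 1 + max (Real.log (r₀ ^ d * ρ) + A) 0 / L ≤ (1 + A / L + 1 / L) * (1 + m) := by
          calc _ ≤ 1 + (m + A) / L := by gcongr
            _ ≤ 1 + (m + A) / L + (1 / L + m + A / L * m) := le_add_of_nonneg_right (by positivity)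
            _ = _ := by field_simp; ring
        calc _ ≤ (4 * r₀) ^ d * ((1 + A / L + 1 / L) * (1 + m)) := by gcongr
          _ = _ := by rw [mul_pow]; ring

section

variable {d : ℕ}

/-! ### Integrals of functions of the local scale -/

/-- The measure with density `ρ` (where `ρ` is negative, with density `0`). -/
def densityMeasure (ρ : E d → ℝ) : Measure (E d) :=
  volume.withDensity fun x => ENNReal.ofReal (ρ x)

/-- The sum over the pieces of a function `a` of their scale, as an integral against the density:
the pieces of scale `k` are counted by the mass of `ρ` where it exceeds `c · 2 ^ (k d)`. -/
theorem exists_lintegral_comp_scale_le (hd : 1 ≤ d) : ∃ c C : ℝ, 0 < c ∧ c ≤ 1 ∧ 0 < C ∧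
    ∀ ρ : E d → ℝ, Measurable ρ → IsTame (densityMeasure ρ) → ∀ a : ℤ → ℝ≥0∞,
      ∫⁻ x, a (scale (densityMeasure ρ) x) * (pieceMass (densityMeasure ρ) x)⁻¹ ∂densityMeasure ρ ≤
        ENNReal.ofReal C * ∫⁻ y, ENNReal.ofReal (ρ y) *
          ∑' k : ℤ, (if ((2 : ℝ) ^ k) ^ d < ρ y / c then a k else 0) := by
  obtain ⟨c, hc0, hc1, hc⟩ := exists_lintegral_inv_pieceMass_le (d := d) hd
  refine ⟨c, 8 * 12 ^ d, hc0, hc1, by positivity, fun ρ hρ hν a => ?_⟩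
  have hg : Measurable fun x => ENNReal.ofReal (ρ x) := hρ.ennreal_ofReal
  have hc := hc _ hg hν
  change ∀ k : ℤ, ∫⁻ x in {x | scale (densityMeasure ρ) x = k},
    (pieceMass (densityMeasure ρ) x)⁻¹ ∂(densityMeasure ρ) ≤ _ at hc
  set ν := densityMeasure ρ
  have hD : ∀ k, MeasurableSet {x | scale ν x = k} := fun k =>
    hν.measurable_scale (measurableSet_singleton k)
  have hun : (⋃ k, {x | scale ν x = k}) = Set.univ :=
    Set.eq_univ_of_forall fun x => Set.mem_iUnion.2 ⟨scale ν x, rfl⟩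
  have hdisj : Pairwise (Function.onFun Disjoint fun k => {x | scale ν x = k}) := fun k l hkl =>
    Set.disjoint_left.2 fun x (hx : scale ν x = k) (hx' : scale ν x = l) => hkl (hx ▸ hx')
  have hM : Measurable fun x => (pieceMass ν x)⁻¹ := hν.measurable_pieceMass.inv
  calc ∫⁻ x, a (scale ν x) * (pieceMass ν x)⁻¹ ∂ν
      = ∑' k, ∫⁻ x in {x | scale ν x = k}, a (scale ν x) * (pieceMass ν x)⁻¹ ∂ν := by
        rw [← lintegral_iUnion hD hdisj, hun, Measure.restrict_univ]
    _ = ∑' k, a k * ∫⁻ x in {x | scale ν x = k}, (pieceMass ν x)⁻¹ ∂ν := by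
        refine tsum_congr fun k => ?_
        rw [← lintegral_const_mul _ hM]
        refine setLIntegral_congr_fun (hD k) fun x hx => ?_
        simp only [show scale ν x = k from hx]
    _ ≤ ∑' k, a k * (8 * 12 ^ d * ∫⁻ y, upperPart c k (fun x => ENNReal.ofReal (ρ x)) y) := by
        gcongr with k
        exact hc k
    _ = 8 * 12 ^ d * ∑' k, ∫⁻ y, a k * upperPart c k (fun x => ENNReal.ofReal (ρ x)) y := by
        rw [← ENNReal.tsum_mul_left]
        refine tsum_congr fun k => ?_
        rw [lintegral_const_mul _ (measurable_upperPart hg c k), mul_left_comm]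
    _ = 8 * 12 ^ d * ∫⁻ y, ∑' k, a k * upperPart c k (fun x => ENNReal.ofReal (ρ x)) y := by
        rw [lintegral_tsum fun k => ((measurable_upperPart hg c k).const_mul _).aemeasurable]
    _ = _ := by
        congr 1
        · rw [ENNReal.ofReal_mul (by norm_num), ENNReal.ofReal_pow (by norm_num)]
          simp
        refine lintegral_congr fun y => ?_
        rw [← ENNReal.tsum_mul_left]
        refine tsum_congr fun k => ?_
        simp only [upperPart, Set.indicator_apply, Set.mem_ofPred_eq]
        have : ENNReal.ofReal (c * ((2 : ℝ) ^ k) ^ d) < ENNReal.ofReal (ρ y) ↔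
            ((2 : ℝ) ^ k) ^ d < ρ y / c := by
          rw [ENNReal.ofReal_lt_ofReal_iff_of_nonneg (by positivity), lt_div_iff₀ hc0, mul_comm]
        simp only [this]
        split_ifs
        · rw [mul_comm]
        · simp

/-- The sum over the pieces of their inverse volumes is controlled by `∫ ρ²`. -/
theorem exists_lintegral_pow_scale_le (hd : 1 ≤ d) : ∃ C : ℝ, 0 < C ∧
    ∀ ρ : E d → ℝ, Measurable ρ → 0 ≤ ρ → IsTame (densityMeasure ρ) →
      ∫⁻ x, ENNReal.ofReal (((2 : ℝ) ^ (scale (densityMeasure ρ) x)) ^ d) *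
          (pieceMass (densityMeasure ρ) x)⁻¹ ∂densityMeasure ρ ≤
        ENNReal.ofReal C * ∫⁻ y, ENNReal.ofReal (ρ y) ^ 2 := by
  obtain ⟨c, C, hc0, -, hC, h⟩ := exists_lintegral_comp_scale_le (d := d) hd
  obtain ⟨C', hC', h'⟩ := exists_tsum_pow_le hd
  refine ⟨C * (C' / c), by positivity, fun ρ hρ hρ0 hν => ?_⟩
  refine (h ρ hρ hν fun k => ENNReal.ofReal (((2 : ℝ) ^ k) ^ d)).trans ?_
  rw [ENNReal.ofReal_mul hC.le, mul_assoc, ← lintegral_const_mul _ (hρ.ennreal_ofReal.pow_const 2)]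
  refine mul_le_mul_right (lintegral_mono fun y => ?_) _
  refine (mul_le_mul_right (h' _) _).trans (le_of_eq ?_)
  have := hρ0 y
  rw [← ENNReal.ofReal_pow this, ← ENNReal.ofReal_mul this, ← ENNReal.ofReal_mul (by positivity)]
  congr 1
  ring

theorem exists_mul_tsum_shellSum_radialProfile_le (hd : 1 ≤ d) {α s c : ℝ} (hα : (d : ℝ) ≤ α)
    (hs : (d : ℝ) < s) (hc0 : 0 < c) (hc1 : c ≤ 1) : ∃ C : ℝ, 0 < C ∧
    ∀ κ r₀ r : ℝ, 0 < κ → 0 ≤ r₀ → 0 ≤ r →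
      ENNReal.ofReal r * ∑' k : ℤ, (if ((2 : ℝ) ^ k) ^ d < r / c then
          shellSum d (radialProfile κ r₀ α s) k else 0) ≤
        ENNReal.ofReal (C * κ) * ENNReal.ofReal r ^ 2 +
          if (d : ℝ) < α then ENNReal.ofReal (C * κ * r₀ ^ α) * ENNReal.ofReal r ^ (1 + α / d)
          else ENNReal.ofReal (C * κ * r₀ ^ d) * (ENNReal.ofReal r ^ 2 +
            ENNReal.ofReal r ^ 2 * ENNReal.ofReal (max (Real.log (r₀ ^ d * r)) 0)) := by
  have hd0 : (0 : ℝ) < d := by exact_mod_cast hd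
  obtain ⟨C₁, hC₁, h₁⟩ := exists_tsum_shellSum_le hd
  obtain ⟨C₂, hC₂, h₂⟩ := exists_dyadicTail_decay_le hd hs
  -- the part of the estimate that does not depend on the power at the origin
  have key : ∀ κ r₀ r : ℝ, 0 < κ → 0 ≤ r₀ → 0 ≤ r →
      ENNReal.ofReal r * ∑' k : ℤ, (if ((2 : ℝ) ^ k) ^ d < r / c then
          shellSum d (radialProfile κ r₀ α s) k else 0) ≤
        ENNReal.ofReal (C₁ / c * C₂ * κ) * ENNReal.ofReal r ^ 2 +
          ENNReal.ofReal (C₁ / c * κ) * ENNReal.ofReal r ^ 2 * dyadicTail d (coreProfile r₀ α) (r / c) := by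
    intro κ r₀ r hκ hr₀ hr
    calc _ ≤ ENNReal.ofReal r * (ENNReal.ofReal (C₁ * (r / c)) * (ENNReal.ofReal κ *
          (dyadicTail d (coreProfile r₀ α) (r / c) + ENNReal.ofReal C₂))) := by
          gcongr
          refine (h₁ _ _).trans ?_
          rw [dyadicTail_radialProfile]
          gcongr
          exact h₂ _
      _ = ENNReal.ofReal (C₁ / c * κ) * ENNReal.ofReal r ^ 2 *
          (dyadicTail d (coreProfile r₀ α) (r / c) + ENNReal.ofReal C₂) := by
          rw [← mul_assoc, ← mul_assoc, ← ENNReal.ofReal_mul hr, ← ENNReal.ofReal_mul (by positivity),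
            ← ENNReal.ofReal_pow hr, ← ENNReal.ofReal_mul (by positivity)]
          congr 2
          ring
      _ = _ := by
          rw [mul_add, add_comm, mul_right_comm, ← ENNReal.ofReal_mul (by positivity)]
          congr 3
          ring
  rcases hα.lt_or_eq with hlt | rfl
  · have hα0 : 0 < α := hd0.trans hlt
    obtain ⟨C₃, hC₃, h₃⟩ := exists_dyadicTail_core_le hd hlt
    refine ⟨max (C₁ / c * C₂) (C₁ * C₃ / c ^ (α / d)), by positivity, fun κ r₀ r hκ hr₀ hr => ?_⟩
    rw [if_pos hlt]
    refine (key κ r₀ r hκ hr₀ hr).trans (add_le_add ?_ ?_)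
    · gcongr
      exact le_max_left _ _
    · rcases hr.eq_or_lt with rfl | hr'
      · simp
      refine (mul_le_mul_right (h₃ r₀ (r / c) hr₀ (by positivity)) _).trans ?_
      rw [← ENNReal.ofReal_pow hr, ENNReal.ofReal_rpow_of_nonneg hr (by positivity),
        ← ENNReal.ofReal_mul (by positivity), ← ENNReal.ofReal_mul (by positivity),
        ← ENNReal.ofReal_mul (by positivity)]
      refine ENNReal.ofReal_le_ofReal ?_
      calc C₁ / c * κ * r ^ 2 * (C₃ * r₀ ^ α * (r / c) ^ (α / d - 1))
          = C₁ * C₃ / c ^ (α / d) * κ * r₀ ^ α * r ^ (1 + α / d) := by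
            rw [Real.rpow_sub_one (by positivity), Real.div_rpow hr hc0.le, Real.rpow_add hr',
              Real.rpow_one]
            field_simp
        _ ≤ _ := by
            gcongr
            exact le_max_right _ _
  · obtain ⟨C₃, hC₃, h₃⟩ := exists_dyadicTail_core_log_le hd hc0 hc1
    refine ⟨max (C₁ / c * C₂) (C₁ / c * C₃), by positivity, fun κ r₀ r hκ hr₀ hr => ?_⟩
    rw [if_neg (lt_irrefl _)]
    refine (key κ r₀ r hκ hr₀ hr).trans (add_le_add ?_ ?_)
    · gcongr
      exact le_max_left _ _
    · refine (mul_le_mul_right (h₃ r₀ r hr₀ hr) _).trans ?_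
      calc _ = ENNReal.ofReal (C₁ / c * C₃ * κ * r₀ ^ d) * (ENNReal.ofReal r ^ 2 +
            ENNReal.ofReal r ^ 2 * ENNReal.ofReal (max (Real.log (r₀ ^ d * r)) 0)) := by
            have : C₁ / c * C₃ * κ * r₀ ^ d = (C₁ / c * κ) * (C₃ * r₀ ^ d) := by ring
            rw [this, ENNReal.ofReal_mul (p := C₁ / c * κ) (by positivity)]
            ring
        _ ≤ _ := by
            gcongr
            exact le_max_right _ _

/-- The integral of the bound on the interaction per point is controlled by the energy terms. -/
theorem exists_lintegral_shellSum_scale_le (hd : 1 ≤ d) {α s : ℝ} (hα : (d : ℝ) ≤ α)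
    (hs : (d : ℝ) < s) : ∃ C : ℝ, 0 < C ∧
    ∀ ρ : E d → ℝ, Measurable ρ → 0 ≤ ρ → IsTame (densityMeasure ρ) →
      ∀ κ r₀ : ℝ, 0 < κ → 0 ≤ r₀ →
        ∫⁻ x, shellSum d (radialProfile κ r₀ α s) (scale (densityMeasure ρ) x) ∂densityMeasure ρ ≤
          ENNReal.ofReal (C * κ) * (∫⁻ y, ENNReal.ofReal (ρ y) ^ 2) + coreTerm C κ r₀ α ρ := by
  obtain ⟨c, C₁, hc0, hc1, hC₁, h₁⟩ := exists_lintegral_comp_scale_le (d := d) hd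
  obtain ⟨C₂, hC₂, h₂⟩ := exists_mul_tsum_shellSum_radialProfile_le hd hα hs hc0 hc1
  refine ⟨C₁ * C₂, by positivity, fun ρ hρ hρ0 hν κ r₀ hκ hr₀ => ?_⟩
  have hg : Measurable fun x => ENNReal.ofReal (ρ x) := hρ.ennreal_ofReal
  have hlog : Measurable fun x => ENNReal.ofReal (max (Real.log (r₀ ^ d * ρ x)) 0) :=
    ((hρ.const_mul _).log.max measurable_const).ennreal_ofReal
  set ν := densityMeasure ρ
  let a := shellSum d (radialProfile κ r₀ α s)
  calc ∫⁻ x, a (scale ν x) ∂ν ≤ ∫⁻ x, a (scale ν x) * (pieceMass ν x)⁻¹ ∂ν := by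
        refine lintegral_mono fun x => le_mul_of_one_le_right zero_le ?_
        rw [ENNReal.one_le_inv]
        exact (hν.pieceMass_le x).trans (by simp)
    _ ≤ ENNReal.ofReal C₁ * ∫⁻ y, ENNReal.ofReal (ρ y) *
          ∑' k : ℤ, (if ((2 : ℝ) ^ k) ^ d < ρ y / c then a k else 0) := h₁ ρ hρ hν a
    _ ≤ ENNReal.ofReal C₁ * ∫⁻ y, (ENNReal.ofReal (C₂ * κ) * ENNReal.ofReal (ρ y) ^ 2 +
          if (d : ℝ) < α then ENNReal.ofReal (C₂ * κ * r₀ ^ α) * ENNReal.ofReal (ρ y) ^ (1 + α / d)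
          else ENNReal.ofReal (C₂ * κ * r₀ ^ d) * (ENNReal.ofReal (ρ y) ^ 2 +
            ENNReal.ofReal (ρ y) ^ 2 * ENNReal.ofReal (max (Real.log (r₀ ^ d * ρ y)) 0))) := by
        gcongr with y
        exact h₂ κ r₀ (ρ y) hκ hr₀ (hρ0 y)
    _ = _ := by
        rw [lintegral_add_left ((hg.pow_const 2).const_mul _), lintegral_const_mul _ (hg.pow_const 2),
          mul_add, ← mul_assoc, ← ENNReal.ofReal_mul hC₁.le, ← mul_assoc]
        congr 1
        unfold coreTerm
        split_ifs with h
        · rw [lintegral_const_mul _ (hg.pow_const _), ← mul_assoc, ← ENNReal.ofReal_mul hC₁.le]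
          congr 2
          ring
        · have hm : Measurable fun y => ENNReal.ofReal (ρ y) ^ 2 +
              ENNReal.ofReal (ρ y) ^ 2 * ENNReal.ofReal (max (Real.log (r₀ ^ d * ρ y)) 0) :=
            (hg.pow_const 2).add ((hg.pow_const 2).mul hlog)
          rw [lintegral_const_mul _ hm,
            lintegral_add_left (hg.pow_const 2), ← mul_assoc, ← ENNReal.ofReal_mul hC₁.le]
          congr 2
          ring

end

section

variable {d N : ℕ}

/-! ### Mixtures of product states -/

theorem lintegral_prod_apply_eq_prod {n : ℕ} (f : Fin n → E d → ℝ≥0∞) (hf : ∀ k, Measurable (f k)) :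
    ∫⁻ y : Fin n → E d, ∏ k, f k (y k) = ∏ k, ∫⁻ z, f k z := by
  induction n with
  | zero => simp [volume_pi]
  | succ n ih =>
    have hmp := (volume_preserving_piFinSuccAbove (fun _ : Fin (n + 1) => E d) 0).symm
    rw [← hmp.lintegral_comp_emb (MeasurableEquiv.measurableEmbedding _)]
    simp_rw [Fin.prod_univ_succ]
    rw [← ih (fun (k : Fin n) => f k.succ) fun (k : Fin n) => hf k.succ]
    exact lintegral_prod_mul (hf 0).aemeasurable
      (Finset.measurable_prod _ fun (k : Fin n) _ => (hf k.succ).comp (measurable_pi_apply k)).aemeasurable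

/-- A partition of the space, given by the labels `π`, together with a symmetric probability
distribution `p` on the `N`-tuples of labels whose marginals add up to the masses that the density
`ρ` gives to the parts. -/
structure IsTransport {ι : Type*} [Fintype ι] [DecidableEq ι] (ρ : E d → ℝ) (π : E d → ι)
    (p : (Fin N → ι) → ℝ) : Prop where
  measurable_density : Measurable ρ
  finite : IsFiniteMeasure (densityMeasure ρ)
  measurableSet_fiber : ∀ i, MeasurableSet (π ⁻¹' {i})
  nonneg : ∀ x, 0 ≤ p x
  symm : ∀ (σ : Equiv.Perm (Fin N)) x, p (x ∘ σ) = p x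
  marginal : ∀ i, ∑ x, p x * ∑ k, (if x k = i then (1 : ℝ) else 0) =
    (densityMeasure ρ (π ⁻¹' {i})).toReal
  factorial_mul_le : ∀ x, N.factorial * p x ≤ 1

section

variable {ι : Type*}

/-- The density `ρ` restricted to the part with label `i` and normalised. -/
def cellDensity [DecidableEq ι] (ρ : E d → ℝ) (π : E d → ι) (i : ι) (z : E d) : ℝ≥0∞ :=
  if π z = i then ENNReal.ofReal (ρ z) / densityMeasure ρ (π ⁻¹' {i}) else 0

/-- The mixture, with the weights `p`, of the products of normalised restrictions of `ρ`. -/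
def stateDensity [Fintype ι] [DecidableEq ι] (ρ : E d → ℝ) (π : E d → ι) (p : (Fin N → ι) → ℝ)
    (y : Fin N → E d) : ℝ≥0∞ :=
  ∑ x, ENNReal.ofReal (p x) * ∏ k, cellDensity ρ π (x k) (y k)

/-- The `N`-particle state with density `stateDensity`. -/
def mixtureState [Fintype ι] [DecidableEq ι] (ρ : E d → ℝ) (π : E d → ι) (p : (Fin N → ι) → ℝ) :
    Measure (Fin N → E d) :=
  volume.withDensity (stateDensity ρ π p)

theorem stateDensity_eq [Fintype ι] [DecidableEq ι] (ρ : E d → ℝ) (π : E d → ι)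
    (p : (Fin N → ι) → ℝ) (y : Fin N → E d) :
    stateDensity ρ π p y = ENNReal.ofReal (p fun k => π (y k)) *
      ∏ k, (ENNReal.ofReal (ρ (y k)) / densityMeasure ρ (π ⁻¹' {π (y k)})) := by
  rw [stateDensity, Finset.sum_eq_single fun k => π (y k)]
  · simp [cellDensity]
  · intro x _ hx
    obtain ⟨k, hk⟩ := Function.ne_iff.1 hx
    rw [Finset.prod_eq_zero (Finset.mem_univ k), mul_zero]
    rw [cellDensity, if_neg hk.symm]
  · simp

namespace IsTransport

variable [Fintype ι] [DecidableEq ι] {ρ : E d → ℝ} {π : E d → ι} {p : (Fin N → ι) → ℝ}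

theorem measurable_cellDensity (h : IsTransport ρ π p) (i : ι) : Measurable (cellDensity ρ π i) :=
  Measurable.ite (h.measurableSet_fiber i) (h.measurable_density.ennreal_ofReal.div_const _)
    measurable_const

theorem measurable_stateDensity (h : IsTransport ρ π p) : Measurable (stateDensity ρ π p) :=
  Finset.measurable_sum _ fun x _ => (Finset.measurable_prod _ fun k _ =>
    (h.measurable_cellDensity (x k)).comp (measurable_pi_apply k)).const_mul _

theorem measure_fiber_ne_zero (h : IsTransport ρ π p) {x : Fin N → ι} (hx : p x ≠ 0) (k : Fin N) :
    densityMeasure ρ (π ⁻¹' {x k}) ≠ 0 := by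
  intro h0
  have h1 := h.marginal (x k)
  rw [h0, ENNReal.toReal_zero] at h1
  have h2 := (Finset.sum_eq_zero_iff_of_nonneg fun y _ => mul_nonneg (h.nonneg y)
    (by positivity : (0 : ℝ) ≤ ∑ l, (if y l = x k then (1 : ℝ) else 0))).1 h1 x (Finset.mem_univ x)
  have h3 := (mul_eq_zero.1 h2).resolve_left hx
  have h4 := (Finset.sum_eq_zero_iff_of_nonneg fun l _ => by positivity).1 h3 k (Finset.mem_univ k)
  simp at h4

theorem lintegral_cellDensity_mul (h : IsTransport ρ π p) (i : ι) {g : E d → ℝ≥0∞}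
    (hg : Measurable g) : densityMeasure ρ (π ⁻¹' {i}) * ∫⁻ z, cellDensity ρ π i z * g z =
      ∫⁻ z in π ⁻¹' {i}, g z ∂densityMeasure ρ := by
  have := h.finite
  have e : ∫⁻ z, cellDensity ρ π i z * g z =
      (densityMeasure ρ (π ⁻¹' {i}))⁻¹ * ∫⁻ z in π ⁻¹' {i}, g z ∂densityMeasure ρ := by
    have hr := h.measurable_density.ennreal_ofReal
    conv_rhs => rw [densityMeasure, restrict_withDensity (h.measurableSet_fiber i),
      lintegral_withDensity_eq_lintegral_mul _ hr hg, ← densityMeasure]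
    rw [← lintegral_const_mul _ (hr.mul hg), ← lintegral_indicator (h.measurableSet_fiber i)]
    refine lintegral_congr fun z => ?_
    by_cases hz : π z = i
    · rw [Set.indicator_of_mem (by exact hz), cellDensity, if_pos hz, Pi.mul_apply, div_eq_mul_inv]
      ring
    · rw [Set.indicator_of_notMem (by exact hz), cellDensity, if_neg hz, zero_mul]
  rcases eq_or_ne (densityMeasure ρ (π ⁻¹' {i})) 0 with h0 | h0
  · rw [h0, zero_mul, Measure.restrict_zero_set h0, lintegral_zero_measure]
  · rw [e, ← mul_assoc, ENNReal.mul_inv_cancel h0 (measure_ne_top _ _), one_mul]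

theorem lintegral_cellDensity (h : IsTransport ρ π p) {i : ι}
    (hi : densityMeasure ρ (π ⁻¹' {i}) ≠ 0) : ∫⁻ z, cellDensity ρ π i z = 1 := by
  have := h.finite
  have e := h.lintegral_cellDensity_mul i (g := fun _ => 1) measurable_const
  simp only [mul_one, lintegral_const, Measure.restrict_apply_univ, one_mul] at e
  have h2 : densityMeasure ρ (π ⁻¹' {i}) * ∫⁻ z, cellDensity ρ π i z =
      densityMeasure ρ (π ⁻¹' {i}) * 1 := by rw [e, mul_one]
  exact (ENNReal.mul_right_inj hi (measure_ne_top _ _)).1 h2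

theorem lintegral_stateDensity_mul (h : IsTransport ρ π p) (j : Fin N) {g : E d → ℝ≥0∞}
    (hg : Measurable g) : ∫⁻ y, stateDensity ρ π p y * g (y j) =
      ∑ x, ENNReal.ofReal (p x) * ∫⁻ z, cellDensity ρ π (x j) z * g z := by
  simp_rw [stateDensity, Finset.sum_mul]
  have hm : ∀ x : Fin N → ι, Measurable fun y : Fin N → E d =>
      (∏ k, cellDensity ρ π (x k) (y k)) * g (y j) := fun x =>
    (Finset.measurable_prod _ fun k _ => (h.measurable_cellDensity (x k)).comp
      (measurable_pi_apply k)).mul (hg.comp (measurable_pi_apply j))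
  simp_rw [mul_assoc]
  rw [lintegral_finsetSum _ fun x _ => (hm x).const_mul _]
  refine Finset.sum_congr rfl fun x _ => ?_
  rw [lintegral_const_mul _ (hm x)]
  rcases eq_or_ne (p x) 0 with h0 | h0
  · simp [h0]
  congr 1
  let f : Fin N → E d → ℝ≥0∞ := fun k z => cellDensity ρ π (x k) z * if k = j then g z else 1
  have hf : ∀ k, Measurable (f k) := fun k => by
    refine (h.measurable_cellDensity (x k)).mul ?_
    split_ifs
    · exact hg
    · exact measurable_const
  have e1 : ∀ y : Fin N → E d, (∏ k, cellDensity ρ π (x k) (y k)) * g (y j) = ∏ k, f k (y k) := by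
    intro y
    simp only [f]
    rw [Finset.prod_mul_distrib]
    simp
  simp_rw [e1]
  rw [lintegral_prod_apply_eq_prod f hf, Finset.prod_eq_single j]
  · simp [f]
  · intro k _ hk
    simp only [f, if_neg hk, mul_one]
    exact h.lintegral_cellDensity (h.measure_fiber_ne_zero h0 k)
  · simp

/-- The one-body density of the mixture is `ρ`, tested against functions. -/
theorem lintegral_sum_mixtureState (h : IsTransport ρ π p) {g : E d → ℝ≥0∞} (hg : Measurable g) :
    ∫⁻ y, ∑ j, g (y j) ∂(mixtureState ρ π p) = ∫⁻ z, g z ∂densityMeasure ρ := by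
  have := h.finite
  have hgj : ∀ j : Fin N, Measurable fun y : Fin N → E d => g (y j) := fun j =>
    hg.comp (measurable_pi_apply j)
  rw [lintegral_finsetSum _ fun j _ => hgj j]
  have e1 : ∀ j, ∫⁻ y, g (y j) ∂(mixtureState ρ π p) =
      ∑ x, ENNReal.ofReal (p x) * ∫⁻ z, cellDensity ρ π (x j) z * g z := by
    intro j
    rw [← h.lintegral_stateDensity_mul j hg, mixtureState,
      lintegral_withDensity_eq_lintegral_mul _ h.measurable_stateDensity (hgj j)]
    rfl
  have e2 : ∀ i, ∑ x, ENNReal.ofReal (p x) * ∑ k, (if x k = i then (1 : ℝ≥0∞) else 0) =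
      densityMeasure ρ (π ⁻¹' {i}) := by
    intro i
    rw [← ENNReal.ofReal_toReal (measure_ne_top (densityMeasure ρ) (π ⁻¹' {i})), ← h.marginal i,
      ENNReal.ofReal_sum_of_nonneg fun x _ => mul_nonneg (h.nonneg x) (by positivity)]
    refine Finset.sum_congr rfl fun x _ => ?_
    rw [ENNReal.ofReal_mul (h.nonneg x), ENNReal.ofReal_sum_of_nonneg fun k _ => by positivity]
    congr 1
    refine Finset.sum_congr rfl fun k _ => ?_
    split_ifs <;> simp
  calc _ = ∑ j, ∑ x, ENNReal.ofReal (p x) * ∫⁻ z, cellDensity ρ π (x j) z * g z :=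
        Finset.sum_congr rfl fun j _ => e1 j
    _ = ∑ i, densityMeasure ρ (π ⁻¹' {i}) * ∫⁻ z, cellDensity ρ π i z * g z := by
        simp_rw [← e2, Finset.sum_mul]
        rw [Finset.sum_comm]
        conv_rhs => rw [Finset.sum_comm]
        refine Finset.sum_congr rfl fun x _ => ?_
        simp_rw [mul_assoc, ← Finset.mul_sum]
        congr 1
        simp_rw [Finset.sum_mul]
        rw [Finset.sum_comm]
        simp
    _ = ∑ i, ∫⁻ z in π ⁻¹' {i}, g z ∂densityMeasure ρ :=
        Finset.sum_congr rfl fun i _ => h.lintegral_cellDensity_mul i hg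
    _ = _ := by
        have hun : (⋃ i, π ⁻¹' {i}) = Set.univ :=
          Set.eq_univ_of_forall fun x => Set.mem_iUnion.2 ⟨π x, rfl⟩
        have hdisj : Pairwise (Function.onFun Disjoint fun i => π ⁻¹' {i}) := fun k l hkl =>
          Set.disjoint_left.2 fun x (hx : π x = k) (hx' : π x = l) => hkl (hx ▸ hx')
        rw [← tsum_fintype (L := .unconditional _), ← lintegral_iUnion h.measurableSet_fiber hdisj, hun,
          Measure.restrict_univ]

theorem oneBody_mixtureState (h : IsTransport ρ π p) :
    oneBody (mixtureState ρ π p) = densityMeasure ρ := by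
  ext A hA
  have hi : Measurable (A.indicator (1 : E d → ℝ≥0∞)) := measurable_one.indicator hA
  have e := h.lintegral_sum_mixtureState hi
  have hij : ∀ j : Fin N, Measurable fun y : Fin N → E d => A.indicator (1 : E d → ℝ≥0∞) (y j) :=
    fun j => hi.comp (measurable_pi_apply j)
  rw [lintegral_indicator_one hA, lintegral_finsetSum _ fun j _ => hij j] at e
  rw [← e, oneBody, Measure.finsetSum_apply]
  refine Finset.sum_congr rfl fun j _ => ?_
  rw [Measure.map_apply (measurable_pi_apply j) hA, ← lintegral_indicator_one
    ((measurable_pi_apply j) hA)]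
  rfl

theorem isState_mixtureState (h : IsTransport ρ π p) (hN : 0 < N)
    (hmass : densityMeasure ρ Set.univ = N) : IsState (mixtureState ρ π p) := by
  refine ⟨⟨?_⟩, fun σ => ?_⟩
  · have e := h.lintegral_sum_mixtureState (g := fun _ => 1) measurable_const
    simp only [Finset.sum_const, Finset.card_univ, Fintype.card_fin, nsmul_eq_mul, mul_one,
      lintegral_const, one_mul, hmass] at e
    have hN' : (N : ℝ≥0∞) ≠ 0 := by exact_mod_cast hN.ne'
    exact (ENNReal.mul_right_inj hN' (ENNReal.natCast_ne_top N)).1 (by rw [e, mul_one])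
  · have hmp : MeasurePreserving (fun (x : Fin N → E d) i => x (σ i)) volume volume := by
      have := volume_measurePreserving_piCongrLeft (fun _ : Fin N => E d) σ.symm
      convert this using 1
      ext x i
      have h2 := MeasurableEquiv.piCongrLeft_apply_apply (β := fun _ : Fin N => E d) σ.symm x (σ i)
      rw [Equiv.symm_apply_apply] at h2
      rw [h2]
    have hsymm : ∀ y : Fin N → E d, stateDensity ρ π p (fun i => y (σ i)) = stateDensity ρ π p y := by
      intro y
      rw [stateDensity_eq, stateDensity_eq]
      congr 1
      · exact congrArg ENNReal.ofReal (h.symm σ fun k => π (y k))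
      · exact Equiv.prod_comp σ fun k =>
          (ENNReal.ofReal (ρ (y k)) / densityMeasure ρ (π ⁻¹' {π (y k)}))
    ext A hA
    rw [Measure.map_apply hmp.measurable hA, mixtureState,
      withDensity_apply _ (hmp.measurable hA), withDensity_apply _ hA,
      ← hmp.setLIntegral_comp_preimage hA h.measurable_stateDensity]
    simp only [hsymm]

theorem ae_mixtureState (h : IsTransport ρ π p) :
    ∀ᵐ y ∂(mixtureState ρ π p), p (fun k => π (y k)) ≠ 0 := by
  rw [mixtureState, ae_withDensity_iff h.measurable_stateDensity]
  refine Eventually.of_forall fun y hy h0 => hy ?_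
  rw [stateDensity_eq, h0]
  simp

theorem stateDensity_lt_top (h : IsTransport ρ π p) (y : Fin N → E d) :
    stateDensity ρ π p y < ∞ := by
  rw [stateDensity_eq]
  rcases eq_or_ne (p fun k => π (y k)) 0 with h0 | h0
  · simp [h0]
  · refine ENNReal.mul_lt_top ENNReal.ofReal_lt_top (ENNReal.prod_lt_top fun k _ => ?_)
    exact ENNReal.div_lt_top ENNReal.ofReal_ne_top (h.measure_fiber_ne_zero h0 k)

/-- Pointwise bound on the entropy density, in terms of a bound `θ` on the logarithm of the
density normalised in each part. It rests on `p ≤ 1 / N!`. -/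
theorem stateDensity_mul_log_le (h : IsTransport ρ π p) {θ : E d → ℝ}
    (hθ : ∀ z, 0 < ρ z → densityMeasure ρ (π ⁻¹' {π z}) ≠ 0 →
      Real.log (ρ z / (densityMeasure ρ (π ⁻¹' {π z})).toReal) ≤ θ z) (y : Fin N → E d) :
    (stateDensity ρ π p y).toReal * Real.log (N.factorial * (stateDensity ρ π p y).toReal) ≤
      (stateDensity ρ π p y).toReal * ∑ k, θ (y k) := by
  have := h.finite
  rcases eq_or_ne (stateDensity ρ π p y) 0 with h0 | h0
  · simp [h0]
  refine mul_le_mul_of_nonneg_left ?_ ENNReal.toReal_nonneg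
  rw [stateDensity_eq] at h0 ⊢
  have hp : p (fun k => π (y k)) ≠ 0 := fun hp => h0 (by simp [hp])
  have hm := h.measure_fiber_ne_zero hp
  have hρ : ∀ k, 0 < ρ (y k) := by
    intro k
    by_contra! hk
    refine h0 (mul_eq_zero_of_right _ (Finset.prod_eq_zero (Finset.mem_univ k) ?_))
    rw [ENNReal.ofReal_of_nonpos hk, ENNReal.zero_div]
  have hp0 : 0 < p (fun k => π (y k)) := (h.nonneg _).lt_of_ne' hp
  have hm' : ∀ k, 0 < (densityMeasure ρ (π ⁻¹' {π (y k)})).toReal := fun k =>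
    ENNReal.toReal_pos (hm k) (measure_ne_top _ _)
  have hf : (0 : ℝ) < N.factorial := by exact_mod_cast N.factorial_pos
  rw [ENNReal.toReal_mul, ENNReal.toReal_prod, ENNReal.toReal_ofReal hp0.le]
  simp only [ENNReal.toReal_div, ENNReal.toReal_ofReal (hρ _).le]
  have hprod : ∀ k, 0 < ρ (y k) / (densityMeasure ρ (π ⁻¹' {π (y k)})).toReal := fun k =>
    div_pos (hρ k) (hm' k)
  calc _ ≤ Real.log (∏ k, ρ (y k) / (densityMeasure ρ (π ⁻¹' {π (y k)})).toReal) := by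
        refine Real.log_le_log (mul_pos hf (mul_pos hp0 (Finset.prod_pos fun k _ => hprod k))) ?_
        rw [← mul_assoc]
        exact mul_le_of_le_one_left (Finset.prod_nonneg fun k _ => (hprod k).le)
          (h.factorial_mul_le _)
    _ = ∑ k, Real.log (ρ (y k) / (densityMeasure ρ (π ⁻¹' {π (y k)})).toReal) :=
        Real.log_prod fun k _ => (hprod k).ne'
    _ ≤ _ := Finset.sum_le_sum fun k _ => hθ _ (hρ k) (hm k)

end IsTransport

end

/-! ### Extended-real integrals -/

theorem eintegral_mono_ae {X : Type*} [MeasurableSpace X] {μ : Measure X} {f g : X → EReal}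
    (h : f ≤ᵐ[μ] g) : eintegral μ f ≤ eintegral μ g := by
  refine EReal.sub_le_sub ?_ ?_
  · exact EReal.coe_ennreal_le_coe_ennreal_iff.2 (lintegral_mono_ae (h.mono fun x hx =>
      EReal.toENNReal_le_toENNReal hx))
  · exact EReal.coe_ennreal_le_coe_ennreal_iff.2 (lintegral_mono_ae (h.mono fun x hx =>
      EReal.toENNReal_le_toENNReal (EReal.neg_le_neg_iff.2 hx)))

theorem eintegral_le_lintegral {X : Type*} [MeasurableSpace X] (μ : Measure X) (f : X → EReal) :
    eintegral μ f ≤ ((∫⁻ x, (f x).toENNReal ∂μ : ℝ≥0∞) : EReal) := by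
  have h : eintegral μ f ≤ ((∫⁻ x, (f x).toENNReal ∂μ : ℝ≥0∞) : EReal) - 0 :=
    EReal.sub_le_sub le_rfl (EReal.coe_ennreal_nonneg _)
  simpa using h

theorem eintegral_coe {X : Type*} [MeasurableSpace X] {μ : Measure X} {f : X → ℝ}
    (hf : Integrable f μ) : eintegral μ (fun x => (f x : EReal)) = ((∫ x, f x ∂μ : ℝ) : EReal) := by
  rw [integral_eq_lintegral_pos_part_sub_lintegral_neg_part hf, EReal.coe_sub]
  have h1 : ∫⁻ x, ENNReal.ofReal (f x) ∂μ ≠ ∞ := hf.lintegral_lt_top.ne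
  have h2 : ∫⁻ x, ENNReal.ofReal (-f x) ∂μ ≠ ∞ := hf.neg.lintegral_lt_top.ne
  rw [EReal.coe_ennreal_toReal h1, EReal.coe_ennreal_toReal h2]
  rfl

/-! ### The interaction energy of separated configurations -/

/-- A point outside the neighbourhood of `x` lies in some dyadic shell around `x`: the grid distance
is less than `2 ^ (l + 1)`, and the minimality of `l` bounds the distance from below. -/
theorem exists_shell {k : ℤ} {x y : E d} (h : y ∉ nbhd k x) : ∃ l : ℕ,
    (∀ i, |gridIdx k y i - gridIdx k x i| < 2 ^ (l + 1)) ∧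
      (2 : ℝ) ^ ((l : ℤ) - 1 - k) ≤ ‖y - x‖ := by
  have hex : ∃ l : ℕ, ∀ i, |gridIdx k y i - gridIdx k x i| < 2 ^ (l + 1) := by
    obtain ⟨n, hn⟩ := pow_unbounded_of_one_lt
      (∑ i, |gridIdx k y i - gridIdx k x i|) (one_lt_two (α := ℤ))
    refine ⟨n, fun i => lt_of_le_of_lt (Finset.single_le_sum
      (f := fun i => |gridIdx k y i - gridIdx k x i|) (fun i _ => abs_nonneg _)
      (Finset.mem_univ i)) (hn.trans ?_)⟩
    rw [pow_succ]
    have : (0 : ℤ) < 2 ^ n := by positivity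
    omega
  classical
  refine ⟨Nat.find hex, Nat.find_spec hex, ?_⟩
  set l := Nat.find hex with hl
  have hl0 : l ≠ 0 := by
    intro h0
    have hsp := Nat.find_spec hex
    rw [← hl, h0] at hsp
    exact h fun i => by have := hsp i; norm_num at this; omega
  obtain ⟨m, hm⟩ := Nat.exists_eq_succ_of_ne_zero hl0
  have hmin := Nat.find_min hex (m := m) (by omega)
  push Not at hmin
  obtain ⟨i, hi⟩ := hmin
  have h2 : (2 : ℤ) ≤ 2 ^ (m + 1) := by
    rw [pow_succ]
    have : (0 : ℤ) < 2 ^ m := by positivity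
    omega
  refine le_trans (le_of_eq ?_) (le_norm_sub_of_gridIdx h2 hi)
  rw [hm]
  push_cast
  rw [← zpow_natCast, zpow_sub₀ two_ne_zero, zpow_sub₀ two_ne_zero, zpow_neg]
  push_cast
  rw [zpow_one, div_eq_mul_inv _ ((2 : ℝ) ^ k)]

open Classical in
/-- The points of coarser or equal scale lie in distinct cubes of side `2 ^ (-(k + 1))`, so that at
most `(2 ^ (l + 2)) ^ d` of them lie in the `l`-th shell. -/
theorem sum_le_shellSum {ν : Measure (E d)} {y : Fin N → E d}
    (hy : ∀ j k, j ≠ k → ¬ IsNear ν (y j) (y k)) {u : ℝ → ℝ≥0∞} (hu : AntitoneOn u (Set.Ici 0))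
    (j : Fin N) :
    ∑ i with i ≠ j ∧ scale ν (y i) ≤ scale ν (y j), u ‖y i - y j‖ ≤
      shellSum d u (scale ν (y j)) := by
  set k := scale ν (y j) with hk
  set S := Finset.univ.filter fun i => i ≠ j ∧ scale ν (y i) ≤ k with hS
  have hterm : ∀ i ∈ S, u ‖y i - y j‖ ≤ ∑' l : ℕ,
      if ∀ c, |gridIdx (k + 1) (y i) c - gridIdx (k + 1) (y j) c| < 2 ^ (l + 1) then
        u (2 ^ ((l : ℤ) - k - 2)) else 0 := by
    intro i hi
    obtain ⟨-, hij, hik⟩ := Finset.mem_filter.1 hi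
    have hn : y i ∉ nbhd (k + 1) (y j) := by
      intro h
      refine hy j i hij.symm (nbhd_antitone (y j) ?_ h)
      rw [← hk, min_eq_right hik]
      omega
    obtain ⟨l, hl1, hl2⟩ := exists_shell hn
    refine le_trans ?_ (ENNReal.le_tsum l)
    rw [if_pos hl1]
    have e : (l : ℤ) - 1 - (k + 1) = l - k - 2 := by ring
    rw [e] at hl2
    exact hu (Set.mem_Ici.2 (by positivity)) (Set.mem_Ici.2 (norm_nonneg _)) hl2
  have hcard : ∀ l : ℕ, (S.filter fun i => ∀ c,
      |gridIdx (k + 1) (y i) c - gridIdx (k + 1) (y j) c| < 2 ^ (l + 1)).card ≤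
        (2 ^ (l + 2)) ^ d := by
    intro l
    let F : Finset (Fin d → ℤ) := Fintype.piFinset fun c =>
      Finset.Ioo (gridIdx (k + 1) (y j) c - 2 ^ (l + 1)) (gridIdx (k + 1) (y j) c + 2 ^ (l + 1))
    have hF : F.card ≤ (2 ^ (l + 2)) ^ d := by
      rw [Fintype.card_piFinset]
      refine (Finset.prod_le_pow_card _ _ (2 ^ (l + 2)) fun c _ => ?_).trans (by simp)
      rw [Int.card_Ioo, Int.toNat_le]
      push_cast
      have : (2 : ℤ) ^ (l + 2) = 2 ^ (l + 1) + 2 ^ (l + 1) := by ring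
      omega
    refine (Finset.card_le_card_of_injOn (fun i => gridIdx (k + 1) (y i)) ?_ ?_).trans hF
    · intro i hi
      have h2 := (Finset.mem_filter.1 hi).2
      refine Finset.mem_coe.2 (Fintype.mem_piFinset.2 fun c => ?_)
      have := abs_lt.1 (h2 c)
      rw [Finset.mem_Ioo]
      constructor <;> linarith
    · intro i hi i' hi' heq
      by_contra hne
      have h1 := (Finset.mem_filter.1 (Finset.mem_filter.1 hi).1).2.2
      have heq : gridIdx (k + 1) (y i) = gridIdx (k + 1) (y i') := heq
      have hle : min (scale ν (y i)) (scale ν (y i')) + 1 ≤ k + 1 := by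
        have := min_le_left (scale ν (y i)) (scale ν (y i'))
        omega
      refine hy i i' hne fun c => ?_
      rw [gridIdx_congr_of_le hle heq]
      simp
  calc ∑ i ∈ S, u ‖y i - y j‖ ≤ ∑ i ∈ S, ∑' l : ℕ,
        (if ∀ c, |gridIdx (k + 1) (y i) c - gridIdx (k + 1) (y j) c| < 2 ^ (l + 1) then
          u (2 ^ ((l : ℤ) - k - 2)) else 0) := Finset.sum_le_sum hterm
    _ = ∑' l : ℕ, ∑ i ∈ S,
        (if ∀ c, |gridIdx (k + 1) (y i) c - gridIdx (k + 1) (y j) c| < 2 ^ (l + 1) then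
          u (2 ^ ((l : ℤ) - k - 2)) else 0) :=
        (Summable.tsum_finsetSum fun _ _ => ENNReal.summable).symm
    _ ≤ shellSum d u k := by
        refine ENNReal.tsum_le_tsum fun l => ?_
        rw [← Finset.sum_filter, Finset.sum_const, nsmul_eq_mul]
        gcongr
        rw [ENNReal.ofReal_pow (by positivity), ENNReal.ofReal_pow (by positivity)]
        have := hcard l
        calc _ ≤ (((2 ^ (l + 2)) ^ d : ℕ) : ℝ≥0∞) := by exact_mod_cast this
          _ = _ := by push_cast; norm_num

/-- In a configuration without near pairs, each pair is charged to its point of finer scale. -/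
theorem sum_pairs_le_sum_shellSum {ν : Measure (E d)} {y : Fin N → E d}
    (hy : ∀ j k, j ≠ k → ¬ IsNear ν (y j) (y k)) {u : ℝ → ℝ≥0∞} (hu : AntitoneOn u (Set.Ici 0)) :
    ∑ p : Fin N × Fin N with p.1 < p.2, u ‖y p.1 - y p.2‖ ≤
      ∑ j, shellSum d u (scale ν (y j)) := by
  classical
  let A : Fin N × Fin N → ℝ≥0∞ := fun p =>
    if p.2 ≠ p.1 ∧ scale ν (y p.2) ≤ scale ν (y p.1) then u ‖y p.2 - y p.1‖ else 0
  have h1 : ∀ p ∈ (Finset.univ.filter fun p : Fin N × Fin N => p.1 < p.2),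
      u ‖y p.1 - y p.2‖ ≤ A p + A p.swap := by
    intro p hp
    have hlt := (Finset.mem_filter.1 hp).2
    rcases le_total (scale ν (y p.2)) (scale ν (y p.1)) with h | h
    · refine le_trans (le_of_eq ?_) le_self_add
      simp only [A]
      rw [if_pos ⟨hlt.ne', h⟩, norm_sub_rev]
    · refine le_trans (le_of_eq ?_) le_add_self
      simp only [A, Prod.fst_swap, Prod.snd_swap]
      rw [if_pos ⟨hlt.ne, h⟩]
  have h2 : ∑ p : Fin N × Fin N with p.1 < p.2, A p.swap =
      ∑ p : Fin N × Fin N with p.2 < p.1, A p := by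
    rw [Finset.sum_filter, Finset.sum_filter, ← (Equiv.prodComm (Fin N) (Fin N)).sum_comp]
    rfl
  calc _ ≤ ∑ p : Fin N × Fin N with p.1 < p.2, (A p + A p.swap) := Finset.sum_le_sum h1
    _ = ∑ p : Fin N × Fin N with p.1 < p.2 ∨ p.2 < p.1, A p := by
        rw [Finset.sum_add_distrib, h2, Finset.filter_or, Finset.sum_union]
        refine Finset.disjoint_filter.2 fun p _ h h' => absurd h h'.not_gt
    _ ≤ ∑ p : Fin N × Fin N, A p := Finset.sum_le_sum_of_subset (Finset.subset_univ _)
    _ = ∑ j, ∑ i with i ≠ j ∧ scale ν (y i) ≤ scale ν (y j), u ‖y i - y j‖ := by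
        rw [Fintype.sum_prod_type]
        refine Finset.sum_congr rfl fun j _ => ?_
        rw [Finset.sum_filter]
    _ ≤ _ := Finset.sum_le_sum fun j _ => by convert sum_le_shellSum hy hu j

theorem toENNReal_pairEnergy_le {w : E d → EReal} {U : E d → ℝ≥0∞}
    (hw : ∀ x, w x ≤ ((U x : ℝ≥0∞) : EReal)) (y : Fin N → E d) :
    (pairEnergy w y).toENNReal ≤ ∑ p : Fin N × Fin N with p.1 < p.2, U (y p.1 - y p.2) := by
  have h : pairEnergy w y ≤
      ((∑ p : Fin N × Fin N with p.1 < p.2, U (y p.1 - y p.2) : ℝ≥0∞) : EReal) := by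
    have hsum : ((∑ p : Fin N × Fin N with p.1 < p.2, U (y p.1 - y p.2) : ℝ≥0∞) : EReal) =
        ∑ p : Fin N × Fin N with p.1 < p.2, ((U (y p.1 - y p.2) : ℝ≥0∞) : EReal) :=
      map_sum (⟨⟨(↑), EReal.coe_ennreal_zero⟩, EReal.coe_ennreal_add⟩ : ℝ≥0∞ →+ EReal) _ _
    rw [hsum]
    exact Finset.sum_le_sum fun p _ => hw _
  simpa using EReal.toENNReal_le_toENNReal h

/-! ### Existence of a separated state -/

theorem sum_measure_fiber {X ι : Type*} [MeasurableSpace X] [Fintype ι] {ν : Measure X}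
    [IsFiniteMeasure ν] {π : X → ι} (hπ : ∀ i, MeasurableSet (π ⁻¹' {i})) (q : ι → Prop)
    [DecidablePred q] : ∑ i, (if q i then (ν (π ⁻¹' {i})).toReal else 0) = (ν {x | q (π x)}).toReal := by
  classical
  rw [← Finset.sum_filter, ← ENNReal.toReal_sum fun i _ => measure_ne_top _ _,
    ← measure_biUnion_finset (f := fun i => π ⁻¹' {i}) (fun k _ l _ hkl => Set.disjoint_left.2
      fun x (hx : π x = k) (hx' : π x = l) => hkl (hx ▸ hx')) fun i _ => hπ i]
  congr 2
  ext x
  simp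

theorem IsTame.exists_measure_scale_le {ν : Measure (E d)} (hν : IsTame ν) :
    ∃ L : ℕ, ν {x | scale ν x ≤ -(L : ℤ)} ≤ 1 / 4 := by
  have := hν.finite
  have hanti : Antitone fun n : ℕ => {x | scale ν x ≤ -(n : ℤ)} := by
    intro m n hmn x hx
    have hx : scale ν x ≤ -(n : ℤ) := hx
    change scale ν x ≤ -(m : ℤ)
    omega
  have hm : ∀ n : ℕ, NullMeasurableSet {x | scale ν x ≤ -(n : ℤ)} ν := fun n =>
    (hν.measurable_scale measurableSet_Iic).nullMeasurableSet
  have h := tendsto_measure_iInter_atTop hm hanti ⟨0, measure_ne_top _ _⟩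
  have hempty : (⋂ n : ℕ, {x | scale ν x ≤ -(n : ℤ)}) = ∅ := by
    refine Set.eq_empty_of_forall_notMem fun x hx => ?_
    have : scale ν x ≤ -(((scale ν x).natAbs + 1 : ℕ) : ℤ) := Set.mem_iInter.1 hx _
    omega
  rw [hempty, measure_empty] at h
  obtain ⟨n, hn⟩ := (h.eventually (gt_mem_nhds (show (0 : ℝ≥0∞) < 1 / 4 by simp))).exists
  exact ⟨n, hn.le⟩

theorem exists_measure_compl_closedBall_le (ν : Measure (E d)) [IsFiniteMeasure ν] :
    ∃ B : ℕ, ν (Metric.closedBall 0 (B : ℝ))ᶜ ≤ 1 / 4 := by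
  have hanti : Antitone fun n : ℕ => (Metric.closedBall (0 : E d) (n : ℝ))ᶜ := by
    intro m n hmn
    exact Set.compl_subset_compl.2 (Metric.closedBall_subset_closedBall (by exact_mod_cast hmn))
  have hm : ∀ n : ℕ, NullMeasurableSet (Metric.closedBall (0 : E d) (n : ℝ))ᶜ ν := fun n =>
    Metric.isClosed_closedBall.measurableSet.compl.nullMeasurableSet
  have h := tendsto_measure_iInter_atTop hm hanti ⟨0, measure_ne_top _ _⟩
  have hempty : (⋂ n : ℕ, (Metric.closedBall (0 : E d) (n : ℝ))ᶜ) = ∅ := by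
    refine Set.eq_empty_of_forall_notMem fun x hx => ?_
    obtain ⟨n, hn⟩ := exists_nat_ge ‖x‖
    exact Set.mem_iInter.1 hx n (by simpa using hn)
  rw [hempty, measure_empty] at h
  obtain ⟨n, hn⟩ := (h.eventually (gt_mem_nhds (show (0 : ℝ≥0∞) < 1 / 4 by simp))).exists
  exact ⟨n, hn.le⟩

/-- Only finitely many pieces have a scale bounded from below: a heavy cube of bounded size has to
meet a ball that carries almost all the mass, and so stays in a bounded region. -/
theorem IsTame.exists_finset_piece {ν : Measure (E d)} (hν : IsTame ν) (L : ℕ) :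
    ∃ S : Finset (ℤ × (Fin d → ℤ)), ∀ x, piece ν x ∈ S ↔ -(L : ℤ) ≤ scale ν x := by
  have := hν.finite
  obtain ⟨K, hK⟩ := hν.exists_light
  obtain ⟨B, hB⟩ := exists_measure_compl_closedBall_le ν
  have hfin : {p | ∃ x, -(L : ℤ) ≤ scale ν x ∧ piece ν x = p}.Finite := by
    let Z : ℝ := (B + 2 * 2 ^ (L + 1)) * 2 ^ (K + 1)
    refine (Finset.finite_toSet (Finset.Icc (-(L : ℤ)) K ×ˢ Fintype.piFinset fun _ : Fin d =>
      Finset.Icc ⌊-Z⌋ ⌊Z⌋)).subset ?_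
    rintro _ ⟨x, hx, rfl⟩
    have hxK : scale ν x ≤ K := (hν.scale_le_iff x K).2 (hK x)
    refine Finset.mem_coe.2 (Finset.mem_product.2 ⟨Finset.mem_Icc.2 ⟨hx, hxK⟩,
      Fintype.mem_piFinset.2 fun i => ?_⟩)
    have hheavy := (hν.lt_scale_iff x (-(L : ℤ) - 1)).1 (by omega)
    have hns : ¬ nbhd (-(L : ℤ) - 1) x ⊆ (Metric.closedBall 0 (B : ℝ))ᶜ := fun hsub =>
      absurd (hheavy.trans_le ((measure_mono hsub).trans hB)) (lt_irrefl _)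
    obtain ⟨y, hy1, hy2⟩ := Set.not_subset.1 hns
    rw [Set.notMem_compl_iff, mem_closedBall_zero_iff] at hy2
    have h1 := abs_sub_lt_of_mem_nbhd hy1 i
    have h2 := (norm_coord_le y i).trans hy2
    have e : (2 : ℝ) ^ (-(-(L : ℤ) - 1)) = 2 ^ (L + 1) := by
      rw [← zpow_natCast]; congr 1; push_cast; ring
    rw [e] at h1
    have h3 : |x i| ≤ B + 2 * 2 ^ (L + 1) := by
      have := abs_sub_abs_le_abs_sub (x i) (y i)
      rw [abs_sub_comm] at this
      linarith
    have h4 : |x i * (2 : ℝ) ^ (scale ν x + 1)| ≤ Z := by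
      rw [abs_mul, abs_of_pos (by positivity : (0 : ℝ) < 2 ^ (scale ν x + 1))]
      refine mul_le_mul h3 ?_ (by positivity) (by positivity)
      exact zpow_le_zpow_right₀ one_le_two (by omega)
    rw [abs_le] at h4
    exact Finset.mem_Icc.2 ⟨Int.floor_le_floor h4.1, Int.floor_le_floor h4.2⟩
  refine ⟨hfin.toFinset, fun x => ?_⟩
  rw [Set.Finite.mem_toFinset]
  refine ⟨?_, fun hx => ⟨x, hx, rfl⟩⟩
  rintro ⟨x', hx', he⟩
  have : scale ν x' = scale ν x := congrArg Prod.fst he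
  omega

/-- A density of integral `N` is the one-body density of a mixture of products of its restrictions
to pieces (all points of very coarse scale are put into one part), in which no two particles are
near each other. -/
theorem exists_separated_transport {ρ : E d → ℝ} (hρ : Measurable ρ)
    (hν : IsTame (densityMeasure ρ)) (hN : 0 < N) (hmass : densityMeasure ρ Set.univ = N) :
    ∃ (ι : Type) (_ : Fintype ι) (_ : DecidableEq ι) (π : E d → ι) (p : (Fin N → ι) → ℝ),
      IsTransport ρ π p ∧
      (∀ y : Fin N → E d, p (fun k => π (y k)) ≠ 0 →
        ∀ j k, j ≠ k → ¬ IsNear (densityMeasure ρ) (y j) (y k)) ∧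
      ∀ z, pieceMass (densityMeasure ρ) z ≤ densityMeasure ρ (π ⁻¹' {π z}) := by
  classical
  set ν := densityMeasure ρ with hνdef
  have := hν.finite
  obtain ⟨L, hL⟩ := hν.exists_measure_scale_le
  obtain ⟨S, hS⟩ := hν.exists_finset_piece L
  -- `none` is the part of the points of very coarse scale
  let π : E d → Option S := fun x => if h : piece ν x ∈ S then some ⟨piece ν x, h⟩ else none
  have hπ1 : ∀ x y, -(L : ℤ) ≤ scale ν x → π x = π y → piece ν x = piece ν y := by
    intro x y hx hxy
    have hx' := (hS x).2 hx
    by_cases hy : piece ν y ∈ S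
    · simp only [π, dif_pos hx', dif_pos hy, Option.some.injEq, Subtype.mk.injEq] at hxy
      exact hxy
    · simp [π, dif_pos hx', dif_neg hy] at hxy
  have hπ2 : ∀ x y, piece ν x = piece ν y → π x = π y := by
    intro x y hxy
    simp only [π, hxy]
  have hπ3 : ∀ x y, scale ν x < -(L : ℤ) → π x = π y → scale ν y < -(L : ℤ) := by
    intro x y hx hxy
    by_contra! hy
    have := congrArg Prod.fst (hπ1 y x hy hxy.symm)
    simp only [piece] at this
    omega
  have hπm : ∀ i, MeasurableSet (π ⁻¹' {i}) := by
    intro i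
    have : π = (fun q => if h : q ∈ S then some ⟨q, h⟩ else none) ∘ piece ν := rfl
    rw [this, Set.preimage_comp]
    exact hν.measurable_piece (Set.to_countable _).measurableSet
  let r : Option S → Option S → Prop := fun i j =>
    i = j ∨ ∃ x y, π x = i ∧ π y = j ∧ IsNear ν x y
  have hrefl : ∀ i, r i i := fun i => Or.inl rfl
  have hsymm : ∀ i j, r i j → r j i := by
    rintro i j (h | ⟨x, y, hx, hy, hxy⟩)
    · exact Or.inl h.symm
    · exact Or.inr ⟨y, x, hy, hx, hxy.symm⟩
  have hr : ∀ x y, r (π x) (π y) → -(L : ℤ) ≤ scale ν x → -(L : ℤ) ≤ scale ν y →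
      IsNear ν x y := by
    rintro x y (h | ⟨x', y', hx', hy', hn⟩) hx hy
    · exact (IsNear.refl ν x).congr rfl (hπ1 x y hx h)
    · exact hn.congr (hπ1 x x' hx hx'.symm).symm (hπ1 y y' hy hy'.symm).symm
  let m : Option S → ℝ := fun i => (ν (π ⁻¹' {i})).toReal
  have hm : ∑ i, m i = N := by
    have := sum_measure_fiber (ν := ν) hπm fun _ => True
    simpa [hmass, m] using this
  -- `1 / 4` for the neighbourhood of the part and `1 / 4` for the points of very coarse scale
  have hdeg : ∀ i, ∑ j, (if r j i then m j else 0) ≤ 1 / 2 := by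
    intro i
    have hsum := sum_measure_fiber (ν := ν) hπm fun j => r j i
    refine hsum.trans_le ?_
    have hgoal : ν {x | r (π x) i} ≤ 1 / 4 + 1 / 4 := by
      by_cases hi : ∃ x₀, π x₀ = i
      · obtain ⟨x₀, rfl⟩ := hi
        by_cases h0 : -(L : ℤ) ≤ scale ν x₀
        · have hsub : {x | r (π x) (π x₀)} ⊆ nbhd (scale ν x₀) x₀ ∪ {x | scale ν x ≤ -(L : ℤ)} := by
            intro x hx
            by_cases h1 : -(L : ℤ) ≤ scale ν x
            · exact Or.inl ((hr x x₀ hx h1 h0).symm.mem_nbhd hν)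
            · exact Or.inr (show scale ν x ≤ -(L : ℤ) by omega)
          exact (measure_mono hsub).trans ((measure_union_le _ _).trans
            (add_le_add (hν.measure_nbhd_scale_le x₀) hL))
        · have hsub : {x | r (π x) (π x₀)} ⊆ {x | scale ν x ≤ -(L : ℤ)} := by
            intro x hx
            change scale ν x ≤ -(L : ℤ)
            by_contra! h1
            rcases hx with h | ⟨x', y', hx', hy', hn⟩
            · have := hπ3 x₀ x (by omega) h.symm
              omega
            · have h2 := hπ3 x₀ y' (by omega) hy'.symm
              have h3 := hn.symm.scale_le hν
              have h4 := congrArg Prod.fst (hπ1 x x' h1.le hx'.symm)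
              simp only [piece] at h4
              omega
          exact ((measure_mono hsub).trans hL).trans le_self_add
      · have hsub : {x | r (π x) i} = ∅ := by
          refine Set.eq_empty_of_forall_notMem fun x hx => hi ?_
          rcases hx with h | ⟨-, y', -, hy', -⟩
          · exact ⟨x, h⟩
          · exact ⟨y', hy'⟩
        rw [hsub, measure_empty]
        exact zero_le
    refine (ENNReal.toReal_mono (by finiteness) hgoal).trans (le_of_eq ?_)
    rw [ENNReal.toReal_add (by finiteness) (by finiteness)]
    norm_num
  obtain ⟨p, hp0, hpσ, hpm, hpr, hpf⟩ := exists_symmetric_conflictFree hN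
    (fun i => ENNReal.toReal_nonneg) hm r hrefl hsymm hdeg
  refine ⟨Option S, inferInstance, inferInstance, π, p,
    ⟨hρ, hν.finite, hπm, hp0, hpσ, hpm, hpf⟩, fun y hy j k hjk hn => ?_, fun z => ?_⟩
  · exact hpr _ hy j k hjk (Or.inr ⟨_, _, rfl, rfl, hn⟩)
  · exact measure_mono fun x hx => hπ2 x z hx

/-! ### Entropy and energy of the separated state -/

theorem integrable_densityMeasure_iff {ρ : E d → ℝ} (hρ : Measurable ρ) (hρ0 : 0 ≤ ρ)
    {f : E d → ℝ} :
    Integrable f (densityMeasure ρ) ↔ Integrable fun x => ρ x * f x := by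
  rw [densityMeasure, integrable_withDensity_iff_integrable_smul' hρ.ennreal_ofReal
    (Eventually.of_forall fun _ => ENNReal.ofReal_lt_top)]
  simp only [ENNReal.toReal_ofReal (hρ0 _), smul_eq_mul]

theorem integral_densityMeasure {ρ : E d → ℝ} (hρ : Measurable ρ) (hρ0 : 0 ≤ ρ) (f : E d → ℝ) :
    ∫ x, f x ∂densityMeasure ρ = ∫ x, ρ x * f x := by
  rw [densityMeasure, integral_withDensity_eq_integral_toReal_smul hρ.ennreal_ofReal
    (Eventually.of_forall fun _ => ENNReal.ofReal_lt_top)]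
  simp only [ENNReal.toReal_ofReal (hρ0 _), smul_eq_mul]

/-- The entropy is a one-body integral after the pointwise bound on the entropy density, since the
one-body density of the state is `ρ`. -/
theorem IsTransport.le_entropy {ι : Type*} [Fintype ι] [DecidableEq ι] {ρ : E d → ℝ} {π : E d → ι}
    {p : (Fin N → ι) → ℝ} (h : IsTransport ρ π p) {θ : E d → ℝ}
    (hint : Integrable θ (densityMeasure ρ))
    (hθ : ∀ z, 0 < ρ z → densityMeasure ρ (π ⁻¹' {π z}) ≠ 0 →
      Real.log (ρ z / (densityMeasure ρ (π ⁻¹' {π z})).toReal) ≤ θ z) :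
    ((-∫ z, θ z ∂densityMeasure ρ : ℝ) : EReal) ≤ entropy (mixtureState ρ π p) := by
  set P := mixtureState ρ π p with hP
  have hac : P ≪ volume := withDensity_absolutelyContinuous _ _
  rw [entropy, if_pos hac, EReal.coe_neg, EReal.neg_le_neg_iff]
  have hone := h.oneBody_mixtureState
  have hj : ∀ j : Fin N, Integrable θ (P.map fun x => x j) := by
    intro j
    refine hint.mono_measure ?_
    rw [← hone, oneBody]
    exact Measure.le_iff.2 fun s _ => by
      rw [Measure.finsetSum_apply]
      exact Finset.single_le_sum (f := fun j => P.map (fun x => x j) s) (fun _ _ => zero_le)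
        (Finset.mem_univ j)
  have hj' : ∀ j : Fin N, Integrable (fun y : Fin N → E d => θ (y j)) P := fun j =>
    (hj j).comp_measurable (measurable_pi_apply j)
  have hsum : Integrable (fun y : Fin N → E d => ∑ j, θ (y j)) P :=
    integrable_finsetSum _ fun j _ => hj' j
  have hD := h.measurable_stateDensity
  have hfin : ∀ᵐ y, stateDensity ρ π p y < ∞ := Eventually.of_forall h.stateDensity_lt_top
  have hvol : Integrable fun y : Fin N → E d => (stateDensity ρ π p y).toReal * ∑ j, θ (y j) := by
    simpa only [smul_eq_mul] using (integrable_withDensity_iff_integrable_smul' hD hfin).1 hsum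
  have hval : ∫ y : Fin N → E d, (stateDensity ρ π p y).toReal * ∑ j, θ (y j) =
      ∫ z, θ z ∂densityMeasure ρ := by
    have e1 := integral_withDensity_eq_integral_toReal_smul hD hfin
      fun y : Fin N → E d => ∑ j, θ (y j)
    simp only [smul_eq_mul] at e1
    rw [← e1, ← hone, oneBody, integral_finsetSum_measure fun j _ => hj j]
    rw [show volume.withDensity (stateDensity ρ π p) = P from rfl, integral_finsetSum _ fun j _ => hj' j]
    refine Finset.sum_congr rfl fun j _ => ?_
    rw [integral_map (measurable_pi_apply j).aemeasurable (hj j).aestronglyMeasurable]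
  rw [← hval, ← eintegral_coe hvol]
  refine eintegral_mono_ae ?_
  filter_upwards [Measure.rnDeriv_withDensity volume hD] with y hy
  rw [show P.rnDeriv volume y = stateDensity ρ π p y from hy]
  exact EReal.coe_le_coe_iff.2 (h.stateDensity_mul_log_le hθ y)

theorem IsTransport.interactionEnergy_le {ι : Type*} [Fintype ι] [DecidableEq ι] {ρ : E d → ℝ}
    {π : E d → ι} {p : (Fin N → ι) → ℝ} (h : IsTransport ρ π p) (hν : IsTame (densityMeasure ρ))
    (hsep : ∀ y : Fin N → E d, p (fun k => π (y k)) ≠ 0 →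
      ∀ j k, j ≠ k → ¬ IsNear (densityMeasure ρ) (y j) (y k))
    {w : E d → EReal} {u : ℝ → ℝ≥0∞} (hu : AntitoneOn u (Set.Ici 0))
    (hw : ∀ x, w x ≤ ((u ‖x‖ : ℝ≥0∞) : EReal)) :
    interactionEnergy w (mixtureState ρ π p) ≤
      ((∫⁻ x, shellSum d u (scale (densityMeasure ρ) x) ∂densityMeasure ρ : ℝ≥0∞) : EReal) := by
  refine (eintegral_le_lintegral _ _).trans (EReal.coe_ennreal_le_coe_ennreal_iff.2 ?_)
  have hm : Measurable fun x => shellSum d u (scale (densityMeasure ρ) x) :=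
    (measurable_of_countable (shellSum d u)).comp hν.measurable_scale
  rw [← h.lintegral_sum_mixtureState hm]
  refine lintegral_mono_ae ?_
  filter_upwards [h.ae_mixtureState] with y hy
  exact (toENNReal_pairEnergy_le hw y).trans (sum_pairs_le_sum_shellSum (hsep y hy) hu)

/-! ### The local radius and the local scale -/

/-- The ball of radius `2 ^ (-k)`, with `k` the local scale, has mass at most `1 / 4 < 1`. -/
theorem zpow_neg_scale_lt_localRadius (hd : 1 ≤ d) {ρ : E d → ℝ} (hρ0 : 0 ≤ ρ)
    (hint : Integrable ρ) (h1 : 1 < ∫ y, ρ y) (hν : IsTame (densityMeasure ρ)) (x : E d) :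
    (2 : ℝ) ^ (-(scale (densityMeasure ρ) x)) < localRadius ρ x := by
  by_contra! hle
  have hR : ∫ y in Metric.ball x (localRadius ρ x), ρ y = 1 :=
    (localRadius_isGreatest hd hint h1 x).1
  have h2 : densityMeasure ρ (Metric.ball x (localRadius ρ x)) ≤ 1 / 4 :=
    (measure_mono ((Metric.ball_subset_ball hle).trans (ball_subset_nbhd _ x))).trans
      (hν.measure_nbhd_scale_le x)
  rw [densityMeasure, withDensity_apply _ Metric.isOpen_ball.measurableSet,
    ← ofReal_integral_eq_lintegral_ofReal hint.integrableOn (Eventually.of_forall hρ0), hR,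
    ENNReal.ofReal_one] at h2
  have h3 := ENNReal.toReal_mono (by finiteness) h2
  norm_num at h3

/-- An upper bound for the logarithm of the density normalised in its part: with the local length
`2 ^ (-k)`, split `-log m` into `log (2 ^ (-k)) ^ d` and `log ((2 ^ k) ^ d / m)`, and bound the
second logarithm by its argument. -/
theorem log_div_le {r m : ℝ} (hr : 0 < r) (hm : 0 < m) (k : ℤ) :
    Real.log (r / m) ≤ Real.log r + Real.log (((2 : ℝ) ^ (-k)) ^ d) + ((2 : ℝ) ^ k) ^ d * m⁻¹ := by
  have hk : (0 : ℝ) < ((2 : ℝ) ^ k) ^ d := by positivity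
  have h1 : r / m = r * ((2 : ℝ) ^ (-k)) ^ d * (((2 : ℝ) ^ k) ^ d * m⁻¹) := by
    rw [zpow_neg, inv_pow]
    field_simp
  rw [h1, Real.log_mul (by positivity) (by positivity), Real.log_mul (by positivity) (by positivity)]
  gcongr
  exact Real.log_le_self (by positivity)

theorem integrable_of_eintegral_ne_top {X : Type*} [MeasurableSpace X] {μ : Measure X} {f : X → ℝ}
    (hf : Measurable f) (hneg : ∫⁻ x, ENNReal.ofReal (-f x) ∂μ ≠ ∞)
    (htop : eintegral μ (fun x => (f x : EReal)) ≠ ⊤) : Integrable f μ := by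
  have hpos : ∫⁻ x, ENNReal.ofReal (f x) ∂μ ≠ ∞ := by
    intro h
    refine htop ?_
    have e : eintegral μ (fun x => (f x : EReal)) = ((∫⁻ x, ENNReal.ofReal (f x) ∂μ : ℝ≥0∞) : EReal) -
      ((∫⁻ x, ENNReal.ofReal (-f x) ∂μ : ℝ≥0∞) : EReal) := rfl
    rw [e, h, ← EReal.coe_ennreal_toReal hneg]
    rfl
  refine ⟨hf.aestronglyMeasurable, ?_⟩
  rw [hasFiniteIntegral_iff_norm]
  calc ∫⁻ x, ENNReal.ofReal ‖f x‖ ∂μ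
      ≤ ∫⁻ x, (ENNReal.ofReal (f x) + ENNReal.ofReal (-f x)) ∂μ := by
        refine lintegral_mono fun x => ?_
        rcases le_total 0 (f x) with h | h
        · rw [Real.norm_of_nonneg h]
          exact le_self_add
        · rw [Real.norm_of_nonpos h]
          exact le_add_self
    _ < ∞ := by
        rw [lintegral_add_left hf.ennreal_ofReal]
        exact ENNReal.add_lt_top.2 ⟨hpos.lt_top, hneg.lt_top⟩

/-- The negative part of `ρ log (2 ^ (-k)) ^ d`, with `k` the local scale, has a finite integral,
because the local scale is bounded from above. -/
theorem lintegral_neg_mul_log_scale_ne_top {ρ : E d → ℝ} (hρ0 : 0 ≤ ρ) (hint : Integrable ρ)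
    (hν : IsTame (densityMeasure ρ)) :
    ∫⁻ x, ENNReal.ofReal
      (-(ρ x * Real.log (((2 : ℝ) ^ (-(scale (densityMeasure ρ) x))) ^ d))) ≠ ∞ := by
  obtain ⟨K, hK⟩ := hν.exists_light
  let c : ℝ := d * (max (K : ℝ) 0 * Real.log 2)
  have hle : ∀ x, -(ρ x * Real.log (((2 : ℝ) ^ (-(scale (densityMeasure ρ) x))) ^ d)) ≤
      ρ x * c := by
    intro x
    have hk := (hν.scale_le_iff x K).2 (hK x)
    rw [Real.log_pow, Real.log_zpow, ← mul_neg]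
    refine mul_le_mul_of_nonneg_left ?_ (hρ0 x)
    have : (scale (densityMeasure ρ) x : ℝ) ≤ max (K : ℝ) 0 :=
      le_trans (by exact_mod_cast hk) (le_max_left _ _)
    have h2 : (scale (densityMeasure ρ) x : ℝ) * Real.log 2 ≤ max (K : ℝ) 0 * Real.log 2 :=
      mul_le_mul_of_nonneg_right this (Real.log_nonneg one_le_two)
    calc _ = (d : ℝ) * ((scale (densityMeasure ρ) x : ℝ) * Real.log 2) := by push_cast; ring
      _ ≤ _ := mul_le_mul_of_nonneg_left h2 (Nat.cast_nonneg d)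
  exact ((lintegral_mono fun x => ENNReal.ofReal_le_ofReal (hle x)).trans_lt
    (hint.mul_const c).lintegral_lt_top).ne

theorem coreTerm_mono {C C' κ r₀ α : ℝ} (hC : C ≤ C') (hκ : 0 ≤ κ) (hr₀ : 0 ≤ r₀) (ρ : E d → ℝ) :
    coreTerm C κ r₀ α ρ ≤ coreTerm C' κ r₀ α ρ := by
  unfold coreTerm
  split_ifs <;> gcongr

/-! ### The free energy bound -/

/-- The free energy bound for a measurable density whose energy terms are all finite, with the
local length in place of the local radius. -/
theorem exists_canonicalFreeEnergy_le_of_finite (hd : 1 ≤ d) {α s : ℝ} (hα : (d : ℝ) ≤ α)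
    (hs : (d : ℝ) < s) : ∃ C : ℝ, 0 < C ∧
    ∀ (w : E d → EReal) (κ r₀ : ℝ), IsShortRange w κ r₀ α s → ∀ T : ℝ, 0 < T →
    ∀ (N : ℕ) (ρ : E d → ℝ), 0 < N → Measurable ρ → 0 ≤ ρ → IsTame (densityMeasure ρ) →
      densityMeasure ρ Set.univ = N → Integrable (fun x => ρ x * Real.log (ρ x)) →
      Integrable (fun x => ρ x * Real.log (((2 : ℝ) ^ (-(scale (densityMeasure ρ) x))) ^ d)) →
      ∫⁻ x, ENNReal.ofReal (ρ x) ^ 2 ≠ ∞ → coreTerm C κ r₀ α ρ ≠ ∞ →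
      canonicalFreeEnergy w T N ρ ≤
        ((C * (κ + T) * (∫⁻ x, ENNReal.ofReal (ρ x) ^ 2).toReal + T * (∫ x, ρ x * Real.log (ρ x)) +
          T * (∫ x, ρ x * Real.log (((2 : ℝ) ^ (-(scale (densityMeasure ρ) x))) ^ d)) +
          (coreTerm C κ r₀ α ρ).toReal : ℝ) : EReal) := by
  obtain ⟨C₁, hC₁, h₁⟩ := exists_lintegral_shellSum_scale_le (d := d) hd hα hs
  obtain ⟨C₂, hC₂, h₂⟩ := exists_lintegral_pow_scale_le (d := d) hd
  refine ⟨max C₁ C₂, lt_max_of_lt_left hC₁, ?_⟩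
  intro w κ r₀ hw T hT N ρ hN hρ hρ0 hν hmass hlog hlogR hQ hcore
  obtain ⟨ι, _, _, π, p, htr, hsep, hpm⟩ := exists_separated_transport hρ hν hN hmass
  have hd0 : (0 : ℝ) ≤ d := Nat.cast_nonneg d
  have hκ := hw.kappa_pos
  have hr₀ := hw.r₀_nonneg
  set ν := densityMeasure ρ with hνdef
  have := hν.finite
  set Q := ∫⁻ x, ENNReal.ofReal (ρ x) ^ 2
  have hU : interactionEnergy w (mixtureState ρ π p) ≤
      ((C₁ * κ * Q.toReal + (coreTerm C₁ κ r₀ α ρ).toReal : ℝ) : EReal) := by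
    have hcore₁ : coreTerm C₁ κ r₀ α ρ ≠ ∞ :=
      ne_top_of_le_ne_top hcore (coreTerm_mono (le_max_left _ _) hκ.le hr₀ ρ)
    refine (htr.interactionEnergy_le hν hsep
      (radialProfile_antitoneOn hw.alpha_nonneg (hd0.trans hs.le)) hw.upper_regular).trans ?_
    refine (EReal.coe_ennreal_le_coe_ennreal_iff.2 (h₁ ρ hρ hρ0 hν κ r₀ hκ hr₀)).trans ?_
    have hne : ENNReal.ofReal (C₁ * κ) * Q ≠ ∞ := ENNReal.mul_ne_top ENNReal.ofReal_ne_top hQ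
    rw [← EReal.coe_ennreal_toReal (ENNReal.add_ne_top.2 ⟨hne, hcore₁⟩),
      ENNReal.toReal_add hne hcore₁, ENNReal.toReal_mul, ENNReal.toReal_ofReal (by positivity)]
  -- `ψ` is what `log t ≤ t` leaves, with `t` the inverse mass of the part in units of the local scale
  let ψ : E d → ℝ := fun z => ((2 : ℝ) ^ (scale ν z)) ^ d * (ν (π ⁻¹' {π z})).toReal⁻¹
  let θ : E d → ℝ := fun z =>
    Real.log (ρ z) + Real.log (((2 : ℝ) ^ (-(scale ν z))) ^ d) + ψ z
  have hψ0 : ∀ z, 0 ≤ ψ z := fun z => by positivity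
  have hψm : Measurable ψ := by
    have h3 : Measurable fun z => ((2 : ℝ) ^ (scale ν z)) ^ d :=
      (measurable_of_countable fun k : ℤ => ((2 : ℝ) ^ k) ^ d).comp hν.measurable_scale
    have h4 : Measurable fun z => (ν (π ⁻¹' {π z})).toReal⁻¹ := by
      let _ : MeasurableSpace ι := ⊤
      exact (measurable_of_countable fun i => (ν (π ⁻¹' {i})).toReal⁻¹).comp
        (measurable_to_countable' htr.measurableSet_fiber)
    exact h3.mul h4
  have hψl : ∫⁻ z, ENNReal.ofReal (ψ z) ∂ν ≤ ENNReal.ofReal C₂ * Q := by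
    refine le_trans (lintegral_mono fun z => ?_) (h₂ ρ hρ hρ0 hν)
    rw [ENNReal.ofReal_mul (by positivity)]
    gcongr
    rw [← ENNReal.toReal_inv]
    exact ENNReal.ofReal_toReal_le.trans (ENNReal.inv_le_inv.2 (hpm z))
  have hψt : ENNReal.ofReal C₂ * Q ≠ ∞ := ENNReal.mul_ne_top ENNReal.ofReal_ne_top hQ
  have hψi : Integrable ψ ν := by
    refine ⟨hψm.aestronglyMeasurable, ?_⟩
    rw [hasFiniteIntegral_iff_ofReal (Eventually.of_forall hψ0)]
    exact hψl.trans_lt hψt.lt_top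
  have hψv : ∫ z, ψ z ∂ν ≤ C₂ * Q.toReal := by
    rw [integral_eq_lintegral_of_nonneg_ae (Eventually.of_forall hψ0) hψm.aestronglyMeasurable]
    refine (ENNReal.toReal_mono hψt hψl).trans (le_of_eq ?_)
    rw [ENNReal.toReal_mul, ENNReal.toReal_ofReal hC₂.le]
  have hi1 := (integrable_densityMeasure_iff hρ hρ0).2 hlog
  have hi2 := (integrable_densityMeasure_iff hρ hρ0).2 hlogR
  have hS := htr.le_entropy (θ := θ) ((hi1.add hi2).add hψi) fun z hz hmz =>
    log_div_le hz (ENNReal.toReal_pos hmz (measure_ne_top _ _)) _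
  have hval : ∫ z, θ z ∂ν = (∫ x, ρ x * Real.log (ρ x)) +
      (∫ x, ρ x * Real.log (((2 : ℝ) ^ (-(scale ν x))) ^ d)) + ∫ z, ψ z ∂ν := by
    have e1 : ∫ z, θ z ∂ν = ∫ z, (Real.log (ρ z) + Real.log (((2 : ℝ) ^ (-(scale ν z))) ^ d)) ∂ν +
        ∫ z, ψ z ∂ν := integral_add (hi1.add hi2) hψi
    rw [e1, integral_add hi1 hi2, integral_densityMeasure hρ hρ0, integral_densityMeasure hρ hρ0]
  have hTS : (((T * -∫ z, θ z ∂ν : ℝ)) : EReal) ≤ (T : EReal) * entropy (mixtureState ρ π p) := by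
    rw [EReal.coe_mul]
    exact mul_le_mul_of_nonneg_left hS (EReal.coe_nonneg.2 hT.le)
  have hmem : canonicalFreeEnergy w T N ρ ≤ stateFreeEnergy w T (mixtureState ρ π p) :=
    sInf_le ⟨_, htr.isState_mixtureState hN hmass, htr.oneBody_mixtureState, rfl⟩
  refine hmem.trans ((EReal.sub_le_sub hU hTS).trans ?_)
  rw [← EReal.coe_sub, EReal.coe_le_coe_iff, hval]
  have hcm : (coreTerm C₁ κ r₀ α ρ).toReal ≤ (coreTerm (max C₁ C₂) κ r₀ α ρ).toReal :=
    ENNReal.toReal_mono hcore (coreTerm_mono (le_max_left _ _) hκ.le hr₀ ρ)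
  have hq0 : 0 ≤ Q.toReal := ENNReal.toReal_nonneg
  have e1 : C₁ * κ * Q.toReal ≤ max C₁ C₂ * κ * Q.toReal := by gcongr; exact le_max_left _ _
  have e2 : T * ∫ z, ψ z ∂ν ≤ T * (max C₁ C₂ * Q.toReal) := by
    gcongr
    exact hψv.trans (by gcongr; exact le_max_right _ _)
  nlinarith

theorem eintegral_congr_ae {X : Type*} [MeasurableSpace X] {μ : Measure X} {f g : X → EReal}
    (h : f =ᵐ[μ] g) : eintegral μ f = eintegral μ g :=
  le_antisymm (eintegral_mono_ae h.le) (eintegral_mono_ae h.symm.le)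

/-- The free energy bound for a measurable density. -/
theorem exists_canonicalFreeEnergy_le_of_measurable (hd : 1 ≤ d) {α s : ℝ} (hα : (d : ℝ) ≤ α)
    (hs : (d : ℝ) < s) : ∃ C : ℝ, 0 < C ∧
    ∀ (w : E d → EReal) (κ r₀ : ℝ), IsShortRange w κ r₀ α s → ∀ T : ℝ, 0 < T →
    ∀ (N : ℕ) (ρ : E d → ℝ), 2 ≤ N → Measurable ρ → 0 ≤ ρ → Integrable ρ → ∫ x, ρ x = N →
      Integrable (fun x => ρ x * |Real.log (ρ x)|) →
      canonicalFreeEnergy w T N ρ ≤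
        ((C * (κ + T) : ℝ) : EReal) * ((∫⁻ x, ENNReal.ofReal (ρ x) ^ 2 : ℝ≥0∞) : EReal)
        + ((C * T * ∫ x, ρ x : ℝ) : EReal)
        + ((T * ∫ x, ρ x * Real.log (ρ x) : ℝ) : EReal)
        + (T : EReal) * eintegral volume
            (fun x => ((ρ x * Real.log (localRadius ρ x ^ d) : ℝ) : EReal))
        + ((coreTerm C κ r₀ α ρ : ℝ≥0∞) : EReal) := by
  obtain ⟨C, hC, hmain⟩ := exists_canonicalFreeEnergy_le_of_finite (d := d) hd hα hs
  refine ⟨C, hC, ?_⟩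
  intro w κ r₀ hw T hT N ρ hN hρ hρ0 hint hmass hlog
  have hN2 : (2 : ℝ) ≤ N := by exact_mod_cast hN
  have hκ := hw.kappa_pos
  have hmass' : ∫⁻ x, ENNReal.ofReal (ρ x) = N := by
    rw [← ofReal_integral_eq_lintegral_ofReal hint (Eventually.of_forall hρ0), hmass]
    simp
  have hν : IsTame (densityMeasure ρ) := by
    refine isTame_withDensity hd ?_ ?_
    · rw [hmass']
      refine lt_of_lt_of_le (b := 1) ?_ (by exact_mod_cast (by omega : 1 ≤ N))
      rw [ENNReal.div_lt_iff (by simp) (by simp)]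
      norm_num
    · rw [hmass']
      exact ENNReal.natCast_ne_top N
  have hlog' : Integrable (fun x => ρ x * Real.log (ρ x)) := by
    refine hlog.mono' (hρ.mul hρ.log).aestronglyMeasurable (Eventually.of_forall fun x => ?_)
    rw [norm_mul, Real.norm_of_nonneg (hρ0 x), Real.norm_eq_abs]
  set ν := densityMeasure ρ
  set Q := ∫⁻ x, ENNReal.ofReal (ρ x) ^ 2
  set I := eintegral volume (fun x => ((ρ x * Real.log (localRadius ρ x ^ d) : ℝ) : EReal))
  have hf : Measurable fun x => ρ x * Real.log (((2 : ℝ) ^ (-(scale ν x))) ^ d) :=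
    hρ.mul ((measurable_of_countable fun k : ℤ => Real.log (((2 : ℝ) ^ (-k)) ^ d)).comp
      hν.measurable_scale)
  have hneg := lintegral_neg_mul_log_scale_ne_top hρ0 hint hν
  have hI : eintegral volume (fun x =>
      ((ρ x * Real.log (((2 : ℝ) ^ (-(scale ν x))) ^ d) : ℝ) : EReal)) ≤ I := by
    refine eintegral_mono_ae (Eventually.of_forall fun x => EReal.coe_le_coe_iff.2 ?_)
    refine mul_le_mul_of_nonneg_left (Real.log_le_log (by positivity) ?_) (hρ0 x)
    exact pow_le_pow_left₀ (by positivity)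
      (zpow_neg_scale_lt_localRadius hd hρ0 hint (by rw [hmass]; linarith) hν x).le d
  -- the integrand of `I` is not shown to be measurable, so `I` is only compared from below with the
  -- integral of the logarithm of the local length
  have hIbot : I ≠ ⊥ := by
    refine ne_bot_of_le_ne_bot ?_ hI
    intro h
    have e := integrable_of_eintegral_ne_top hf hneg (by rw [h]; exact bot_ne_top)
    rw [eintegral_coe e] at h
    exact EReal.coe_ne_bot _ h
  have hmul : ∀ J : EReal, J ≠ ⊥ → (T : EReal) * J ≠ ⊥ := by
    intro J hJ
    induction J with
    | bot => exact absurd rfl hJ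
    | coe i => rw [← EReal.coe_mul]; exact EReal.coe_ne_bot _
    | top => rw [EReal.coe_mul_top_of_pos hT]; exact top_ne_bot
  have hTI := hmul I hIbot
  have hcb : ((coreTerm C κ r₀ α ρ : ℝ≥0∞) : EReal) ≠ ⊥ := EReal.coe_ennreal_ne_bot _
  -- if a term on the right is infinite there is nothing to prove, as no term is `-∞`
  by_cases hQ : Q = ∞
  · rw [hQ, EReal.coe_ennreal_top, EReal.coe_mul_top_of_pos (by positivity),
      EReal.top_add_coe, EReal.top_add_coe, EReal.top_add_of_ne_bot hTI,
      EReal.top_add_of_ne_bot hcb]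
    exact le_top
  have hAb : ((C * (κ + T) : ℝ) : EReal) * (Q : EReal) + ((C * T * ∫ x, ρ x : ℝ) : EReal)
      + ((T * ∫ x, ρ x * Real.log (ρ x) : ℝ) : EReal) ≠ ⊥ := by
    rw [← EReal.coe_ennreal_toReal hQ, ← EReal.coe_mul, ← EReal.coe_add, ← EReal.coe_add]
    exact EReal.coe_ne_bot _
  by_cases hcore : coreTerm C κ r₀ α ρ = ∞
  · rw [hcore, EReal.coe_ennreal_top, EReal.add_top_of_ne_bot]
    · exact le_top
    · rw [Ne, EReal.add_eq_bot_iff, not_or]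
      exact ⟨hAb, hTI⟩
  by_cases hItop : I = ⊤
  · rw [hItop, EReal.coe_mul_top_of_pos hT, EReal.add_top_of_ne_bot hAb,
      EReal.top_add_of_ne_bot hcb]
    exact le_top
  have hfi := integrable_of_eintegral_ne_top hf hneg (ne_top_of_le_ne_top hItop hI)
  rw [eintegral_coe hfi] at hI
  have hν1 : ν Set.univ = N := by
    rw [← hmass']
    exact (withDensity_apply _ MeasurableSet.univ).trans (by rw [Measure.restrict_univ])
  refine (hmain w κ r₀ hw T hT N ρ (by omega) hρ hρ0 hν hν1 hlog' hfi hQ hcore).trans ?_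
  rw [EReal.coe_add, EReal.coe_ennreal_toReal hcore]
  refine add_le_add ?_ le_rfl
  rw [EReal.coe_add]
  refine add_le_add ?_ ?_
  · rw [← EReal.coe_ennreal_toReal hQ, ← EReal.coe_mul, ← EReal.coe_add, ← EReal.coe_add,
      EReal.coe_le_coe_iff, hmass]
    have : 0 ≤ C * T * N := by positivity
    linarith
  · rw [EReal.coe_mul]
    exact mul_le_mul_of_nonneg_left hI (EReal.coe_nonneg.2 hT.le)

theorem localRadius_congr_ae {ρ ρ' : E d → ℝ} (h : ρ =ᵐ[volume] ρ') (x : E d) :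
    localRadius ρ x = localRadius ρ' x := by
  have e : ∀ r : ℝ, ∫ y in Metric.ball x r, ρ y = ∫ y in Metric.ball x r, ρ' y := fun r =>
    integral_congr_ae (ae_restrict_of_ae h)
  simp only [localRadius, e]

theorem coreTerm_congr_ae {C κ r₀ α : ℝ} {ρ ρ' : E d → ℝ} (h : ρ =ᵐ[volume] ρ') :
    coreTerm C κ r₀ α ρ = coreTerm C κ r₀ α ρ' := by
  unfold coreTerm
  congr 2
  · exact lintegral_congr_ae (h.mono fun x hx => by simp only [hx])
  · congr 1
    · exact lintegral_congr_ae (h.mono fun x hx => by simp only [hx])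
    · exact lintegral_congr_ae (h.mono fun x hx => by simp only [hx])

theorem canonicalFreeEnergy_congr_ae {w : E d → EReal} {T : ℝ} {N : ℕ} {ρ ρ' : E d → ℝ}
    (h : ρ =ᵐ[volume] ρ') : canonicalFreeEnergy w T N ρ = canonicalFreeEnergy w T N ρ' := by
  unfold canonicalFreeEnergy
  have e : volume.withDensity (fun x => ENNReal.ofReal (ρ x)) =
      volume.withDensity (fun x => ENNReal.ofReal (ρ' x)) :=
    withDensity_congr_ae (h.mono fun x hx => by simp only [hx])
  rw [e]

end

end CanonicalGas

end

open CanonicalGas in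
theorem theorem2p7 (d : ℕ) (hd : 2 ≤ d) (α s : ℝ) (hα : (d : ℝ) ≤ α) (hs : (d : ℝ) < s) :
    ∃ C : ℝ, 0 < C ∧
      ∀ (w : E d → EReal) (κ r₀ : ℝ), IsShortRange w κ r₀ α s →
      ∀ T : ℝ, 0 < T →
      ∀ (N : ℕ) (ρ : E d → ℝ), 2 ≤ N → Integrable ρ → 0 ≤ᵐ[volume] ρ → ∫ x, ρ x = N →
        Integrable (fun x => ρ x * |Real.log (ρ x)|) →
        canonicalFreeEnergy w T N ρ ≤
          ((C * (κ + T) : ℝ) : EReal) * ((∫⁻ x, ENNReal.ofReal (ρ x) ^ 2 : ℝ≥0∞) : EReal)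
          + ((C * T * ∫ x, ρ x : ℝ) : EReal)
          + ((T * ∫ x, ρ x * Real.log (ρ x) : ℝ) : EReal)
          + (T : EReal) * eintegral volume
              (fun x => ((ρ x * Real.log (localRadius ρ x ^ d) : ℝ) : EReal))
          + ((coreTerm C κ r₀ α ρ : ℝ≥0∞) : EReal) := by
  obtain ⟨C, hC, hmain⟩ := exists_canonicalFreeEnergy_le_of_measurable (d := d) (by omega) hα hs
  refine ⟨C, hC, ?_⟩
  intro w κ r₀ hw T hT N ρ hN hint hρ0 hmass hlog
  -- all the quantities depend on `ρ` only up to null sets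
  let ρ' : E d → ℝ := fun x => max (hint.1.mk ρ x) 0
  have hae : ρ =ᵐ[volume] ρ' := by
    filter_upwards [hint.1.ae_eq_mk, hρ0] with x hx hx0
    have hx0 : 0 ≤ ρ x := hx0
    simp only [ρ', ← hx, max_eq_left hx0]
  have hm : Measurable ρ' := hint.1.stronglyMeasurable_mk.measurable.max measurable_const
  have h := hmain w κ r₀ hw T hT N ρ' hN hm (fun x => le_max_right _ _) (hint.congr hae)
    (by rw [← hmass]; exact (integral_congr_ae hae).symm)
    (hlog.congr (hae.mono fun x hx => by simp only [hx]))
  rw [← canonicalFreeEnergy_congr_ae hae, ← coreTerm_congr_ae hae, ← integral_congr_ae hae] at h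
  have e1 : ∫⁻ x, ENNReal.ofReal (ρ' x) ^ 2 = ∫⁻ x, ENNReal.ofReal (ρ x) ^ 2 :=
    lintegral_congr_ae (hae.mono fun x hx => by simp only [hx])
  have e2 : ∫ x, ρ' x * Real.log (ρ' x) = ∫ x, ρ x * Real.log (ρ x) :=
    integral_congr_ae (hae.mono fun x hx => by simp only [hx])
  have e3 : eintegral volume (fun x => ((ρ' x * Real.log (localRadius ρ' x ^ d) : ℝ) : EReal)) =
      eintegral volume (fun x => ((ρ x * Real.log (localRadius ρ x ^ d) : ℝ) : EReal)) :=
    eintegral_congr_ae (hae.mono fun x hx => by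
      simp only [hx, localRadius_congr_ae hae x])
  rwa [e1, e2, e3] at h
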